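/- Let $\mathbb H$ be a complex Hilbert space and let $\mathbb H^{\otimes n}$ be its Hilbert space tensor powers. For a permutation $\pi$ of $\{1,\dots,n\}$ let $U_\pi(x_1\otimes\cdots\otimes x_n)=x_{\pi^{-1}(1)}\otimes\cdots\otimes x_{\pi^{-1}(n)}$, let $A_n=\frac1{n!}\sum_\pi \mathrm{sgn}(\pi)U_\pi$, let $\mathbb H^{(n)}=\{\psi\in\mathbb H^{\otimes n}: U_\pi\psi=\mathrm{sgn}(\pi)\psi \text{ for all } \pi\}$, and let $\mathbb F=\bigoplus_{n\ge 0}\mathbb H^{(n)}$ be the fermion Fock space, with number operator $N$. For an operator $A$ on $\mathbb H^{(n)}$ let $\overline A=A\oplus 0$ be its extension by $0$ to $\mathbb H^{\otimes n}$. For $m\le n$ and a trace class operator $T$ on $\mathbb H^{(n)}$ let the partial trace $T_{:m}$ be the trace class operator on $\mathbb H^{(m)}$ with $\mathrm{Tr}\big((\overline K\otimes I\otimes\cdots\otimes I)\overline T\big)=\mathrm{Tr}(K\,T_{:m})$ for all compact Hermitian $K$ on $\mathbb H^{(m)}$. For a density operator $D$ on $\mathbb F$ (nonnegative, trace class, of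 trace $1$) that commutes with $N$, with $n$-particle components $D_n$, and with $\sum_n n^m\mathrm{Tr}(D_n)<\infty$, the reduced number density of order $m$ is $\mathcal N_m(D)=\sum_{n\ge m}\frac{n!}{(n-m)!}D_{n:m}$, a trace class operator on $\mathbb H^{(m)}$. Let $\{\phi_j\}_{j\in J}$ be an orthonormal basis of $\mathbb H$. For each finite subset $\mathbf s=\{j_1,\dots,j_n\}$ of $J$, listed in an arbitrary chosen order, let $\Psi(\mathbf s)=\sqrt{n!}\,A_n(\phi_{j_1}\otimes\cdots\otimes\phi_{j_n})\in\mathbb H^{(n)}\subset\mathbb F$ be the corresponding Slater determinant ($\Psi(\emptyset)$ is the vacuum vector), and let $P_{\mathbf s}$ be the orthogonal projector of $\mathbb F$ onto the span of $\Psi(\mathbf s)$. Let $\mathbb P$ be a discrete probability measure on the set of finite subsets of $J$ (zero off a countable set) under which the occupation numbers $N_j$, $j\in J$, where $N_j(\mathbf s)=1$ if $j\in\mathbf s$ and $N_j(\mathbf s)=0$ otherwise, are independent. Put $$G=\sum_{\mathbf s}\mathbb P(\mathbf s)P_{\mathbf s}.$$ Then $G$ is a density operator on $\mathbb F$ that commutes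 with $N$ and satisfies $\sum_n n^m\,\mathrm{Tr}(G_n)<\infty$ for all $m\in\mathbb N$, so that all its reduced number densities $\mathcal N_n(G)$ are well defined, and for every $n\in\mathbb N$ $$\overline{\mathcal N_n(G)}=\mathcal N_1(G)^{\otimes n}\,n!\,A_n$$ as operators on $\mathbb H^{\otimes n}$ (where $\mathbb H^{(1)}=\mathbb H$). -/

import Mathlib

noncomputable section

open scoped InnerProductSpace TensorProduct ComplexOrder

namespace FermiFock

variable {H : Type*} [NormedAddCommGroup H] [InnerProductSpace ℂ H]

/-- The algebraic tensor power of `H` with `n` factors. It is a type synonym because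
`PiTensorProduct` carries the projective seminorm, and the Hilbert space norm is needed here. -/
def AlgPow (H : Type*) [NormedAddCommGroup H] [InnerProductSpace ℂ H] (n : ℕ) : Type _ :=
  PiTensorProduct ℂ (fun _ : Fin n => H)

instance (n : ℕ) : AddCommGroup (AlgPow H n) :=
  inferInstanceAs (AddCommGroup (PiTensorProduct ℂ (fun _ : Fin n => H)))

instance (n : ℕ) : Module ℂ (AlgPow H n) :=
  inferInstanceAs (Module ℂ (PiTensorProduct ℂ (fun _ : Fin n => H)))

/-- The simple tensor `x₁ ⊗ ⋯ ⊗ xₙ` in the algebraic tensor power. -/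
def algTprod {n : ℕ} (x : Fin n → H) : AlgPow H n := PiTensorProduct.tprod ℂ x

/-- The multilinear map `y ↦ ∏ₖ ⟪xₖ, yₖ⟫`. -/
def pairMultilinear {n : ℕ} (x : Fin n → H) :
    MultilinearMap ℂ (fun _ : Fin n => H) ℂ :=
  (MultilinearMap.mkPiRing ℂ (Fin n) (1 : ℂ)).compLinearMap
    (fun k => (innerSL ℂ (x k)).toLinearMap)

theorem pairMultilinear_apply {n : ℕ} (x y : Fin n → H) :
    pairMultilinear x y = ∏ k, inner ℂ (x k) (y k) := by
  simp [pairMultilinear]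

/-- The linear functional `⟪x₁ ⊗ ⋯ ⊗ xₙ, ·⟫`. -/
def pairLeft {n : ℕ} (x : Fin n → H) : AlgPow H n →ₗ[ℂ] ℂ :=
  PiTensorProduct.lift (pairMultilinear x)

theorem pairLeft_tprod {n : ℕ} (x y : Fin n → H) :
    pairLeft x (algTprod y) = ∏ k, inner ℂ (x k) (y k) := by
  rw [← pairMultilinear_apply]
  exact PiTensorProduct.lift.tprod y

theorem algPow_hom_ext {n : ℕ} {E : Type*} [AddCommMonoid E] [Module ℂ E]
    {f g : AlgPow H n →ₗ[ℂ] E} (h : ∀ x, f (algTprod x) = g (algTprod x)) : f = g :=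
  PiTensorProduct.ext (MultilinearMap.ext h)

/-- The sesquilinear form with `⟪⊗ₖ xₖ, ⊗ₖ yₖ⟫ = ∏ₖ ⟪xₖ, yₖ⟫`. -/
def form (n : ℕ) : AlgPow H n →+ (AlgPow H n →ₗ[ℂ] ℂ) :=
  PiTensorProduct.liftAddHom
    (fun p : ℂ × (Fin n → H) => (starRingEnd ℂ p.1) • pairLeft p.2)
    (by
      intro r f i hf
      refine algPow_hom_ext fun y => ?_
      simp only [LinearMap.smul_apply, pairLeft_tprod, LinearMap.zero_apply]
      rw [Finset.prod_eq_zero (Finset.mem_univ i) (by simp [hf])]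
      simp)
    (by intro f; simp)
    (by
      intro _ r f i m₁ m₂
      refine algPow_hom_ext fun y => ?_
      simp only [LinearMap.add_apply, LinearMap.smul_apply, pairLeft_tprod, smul_eq_mul,
        ← Finset.mul_prod_erase _ _ (Finset.mem_univ i), Function.update_self, inner_add_left]
      have : ∀ m : H, ∏ k ∈ Finset.univ.erase i, inner ℂ (Function.update f i m k) (y k)
          = ∏ k ∈ Finset.univ.erase i, inner ℂ (f k) (y k) := fun m =>
        Finset.prod_congr rfl fun k hk => by
          rw [Function.update_of_ne (Finset.ne_of_mem_erase hk)]
      simp only [this]; ring)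
    (by intro r r' f; simp [add_smul])
    (by
      intro _ r f i r'
      refine algPow_hom_ext fun y => ?_
      simp only [LinearMap.smul_apply, pairLeft_tprod, smul_eq_mul,
        ← Finset.mul_prod_erase _ _ (Finset.mem_univ i), Function.update_self, inner_smul_left]
      have : ∀ m : H, ∏ k ∈ Finset.univ.erase i, inner ℂ (Function.update f i m k) (y k)
          = ∏ k ∈ Finset.univ.erase i, inner ℂ (f k) (y k) := fun m =>
        Finset.prod_congr rfl fun k hk => by
          rw [Function.update_of_ne (Finset.ne_of_mem_erase hk)]
      simp only [this, map_mul]; ring)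

theorem form_smul_tprod {n : ℕ} (c : ℂ) (x : Fin n → H) :
    form n (c • algTprod x) = (starRingEnd ℂ c) • pairLeft x := by
  have : c • algTprod x = PiTensorProduct.tprodCoeff ℂ c x :=
    (PiTensorProduct.tprodCoeff_eq_smul_tprod c x).symm
  rw [this]
  rfl

theorem algPow_induction {n : ℕ} {P : AlgPow H n → Prop} (z : AlgPow H n)
    (smul : ∀ (c : ℂ) x, P (c • algTprod x)) (add : ∀ a b, P a → P b → P (a + b)) : P z :=
  PiTensorProduct.induction_on z smul add

theorem form_smul {n : ℕ} (c : ℂ) (z : AlgPow H n) :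
    form n (c • z) = (starRingEnd ℂ c) • form n z := by
  induction z using algPow_induction with
  | smul d x => rw [smul_smul, form_smul_tprod, form_smul_tprod, smul_smul, map_mul]
  | add a b ha hb => rw [smul_add, map_add, map_add, ha, hb, smul_add]

theorem form_conj {n : ℕ} (z w : AlgPow H n) :
    starRingEnd ℂ (form n w z) = form n z w := by
  induction z using algPow_induction with
  | add a b ha hb => simp only [map_add, LinearMap.add_apply, ha, hb]
  | smul c x =>
    induction w using algPow_induction with
    | add a b ha hb => simp only [map_add, LinearMap.add_apply, ha, hb]
    | smul d y =>
      simp only [form_smul_tprod, map_smul, LinearMap.smul_apply, pairLeft_tprod, smul_eq_mul,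
        map_mul, map_prod, inner_conj_symm, Complex.conj_conj]
      ring

theorem exists_eq_sum {n : ℕ} (z : AlgPow H n) :
    ∃ (N : ℕ) (c : Fin N → ℂ) (x : Fin N → Fin n → H), z = ∑ i, c i • algTprod (x i) := by
  induction z using algPow_induction with
  | smul c x => exact ⟨1, fun _ => c, fun _ => x, by simp⟩
  | add a b ha hb =>
    obtain ⟨N, c, x, rfl⟩ := ha
    obtain ⟨M, d, y, rfl⟩ := hb
    exact ⟨N + M, Fin.append c d, Fin.append x y, by simp [Fin.sum_univ_add]⟩

/-- The Gram matrix of simple tensors. -/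
def prodGram {n N : ℕ} (x : Fin N → Fin n → H) : Matrix (Fin N) (Fin N) ℂ :=
  Matrix.of fun i j => ∏ k, inner ℂ (x i k) (x j k)

open scoped Matrix in
theorem form_sum_self {n N : ℕ} (c : Fin N → ℂ) (x : Fin N → Fin n → H) :
    form n (∑ i, c i • algTprod (x i)) (∑ i, c i • algTprod (x i))
      = star c ⬝ᵥ (prodGram x *ᵥ c) := by
  simp only [map_sum, LinearMap.sum_apply, form_smul_tprod, map_smul, LinearMap.smul_apply,
    pairLeft_tprod, smul_eq_mul, dotProduct, Matrix.mulVec, prodGram, Matrix.of_apply,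
    Finset.mul_sum, Pi.star_apply]
  rw [Finset.sum_comm]
  refine Finset.sum_congr rfl fun i _ => Finset.sum_congr rfl fun j _ => ?_
  simp only [RCLike.star_def]
  ring

open scoped Matrix in
theorem posSemidef_prod_sub {n N : ℕ} (A B : Fin n → Matrix (Fin N) (Fin N) ℂ)
    (hB : ∀ k, (B k).PosSemidef) (hAB : ∀ k, (A k - B k).PosSemidef) (s : Finset (Fin n)) :
    (Matrix.of fun i j => ∏ k ∈ s, B k i j).PosSemidef ∧
      ((Matrix.of fun i j => ∏ k ∈ s, A k i j) -
        (Matrix.of fun i j => ∏ k ∈ s, B k i j)).PosSemidef := by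
  classical
  induction s using Finset.induction_on with
  | empty =>
    refine ⟨?_, by simpa using Matrix.PosSemidef.zero⟩
    have := Matrix.posSemidef_gram ℂ (fun _ : Fin N => (1 : ℂ))
    have e : (Matrix.of fun i j => ∏ k ∈ (∅ : Finset (Fin n)), B k i j)
        = Matrix.gram ℂ (fun _ : Fin N => (1 : ℂ)) := by
      ext i j
      simp
    rw [e]
    exact this
  | insert k s hk ih =>
    have e : ∀ C : Fin n → Matrix (Fin N) (Fin N) ℂ,
        (Matrix.of fun i j => ∏ l ∈ insert k s, C l i j)
          = (C k) ⊙ (Matrix.of fun i j => ∏ l ∈ s, C l i j) := by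
      intro C; ext i j; simp [Finset.prod_insert hk]
    rw [e A, e B]
    refine ⟨(hB k).hadamard ih.1, ?_⟩
    have := ((hAB k).hadamard ih.1).add (((hAB k).add (hB k)).hadamard ih.2)
    have e' : ∀ P Q : Matrix (Fin N) (Fin N) ℂ, A k ⊙ P - B k ⊙ Q
        = (A k - B k) ⊙ Q + (A k - B k + B k) ⊙ (P - Q) := by
      intro P Q
      ext i j
      simp only [Matrix.sub_apply, Matrix.add_apply, Matrix.hadamard_apply]
      ring
    rw [e']
    exact this

theorem posSemidef_prodGram {n N : ℕ} (x : Fin N → Fin n → H) : (prodGram x).PosSemidef := by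
  have := (posSemidef_prod_sub (fun k => Matrix.gram ℂ (fun i => x i k))
    (fun k => Matrix.gram ℂ (fun i => x i k)) (fun k => Matrix.posSemidef_gram ℂ _)
    (fun k => by simpa using Matrix.PosSemidef.zero) Finset.univ).1
  exact this

/-- The inner product on the algebraic tensor power. -/
@[reducible] def algPowCore (n : ℕ) : PreInnerProductSpace.Core ℂ (AlgPow H n) where
  inner z w := form n z w
  conj_inner_symm z w := form_conj z w
  add_left x y z := by simp
  smul_left x y r := by simp [form_smul]
  re_inner_nonneg z := by
    obtain ⟨N, c, x, rfl⟩ := exists_eq_sum z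
    rw [form_sum_self]
    exact (Complex.nonneg_iff.mp ((posSemidef_prodGram x).dotProduct_mulVec_nonneg c)).1

instance (n : ℕ) : SeminormedAddCommGroup (AlgPow H n) :=
  letI := algPowCore (H := H) n
  InnerProductSpace.Core.toSeminormedAddCommGroup (𝕜 := ℂ)

instance (n : ℕ) : InnerProductSpace ℂ (AlgPow H n) := .ofCore (algPowCore (H := H) n)

theorem inner_algTprod {n : ℕ} (x y : Fin n → H) :
    inner ℂ (algTprod x) (algTprod y) = ∏ k, inner ℂ (x k) (y k) := by
  have := form_smul_tprod 1 x
  rw [one_smul] at this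
  change form n (algTprod x) (algTprod y) = _
  rw [this]; simp [pairLeft_tprod]

/-- The Hilbert space tensor power of `H` with `n` factors: the completion of the algebraic
tensor power for `⟪x₁ ⊗ ⋯ ⊗ xₙ, y₁ ⊗ ⋯ ⊗ yₙ⟫ = ⟪x₁, y₁⟫ ⋯ ⟪xₙ, yₙ⟫`. -/
def HilbertPow (H : Type*) [NormedAddCommGroup H] [InnerProductSpace ℂ H] (n : ℕ) : Type _ :=
  UniformSpace.Completion (AlgPow H n)

instance (n : ℕ) : NormedAddCommGroup (HilbertPow H n) :=
  inferInstanceAs (NormedAddCommGroup (UniformSpace.Completion (AlgPow H n)))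

instance (n : ℕ) : InnerProductSpace ℂ (HilbertPow H n) :=
  inferInstanceAs (InnerProductSpace ℂ (UniformSpace.Completion (AlgPow H n)))

instance (n : ℕ) : CompleteSpace (HilbertPow H n) :=
  inferInstanceAs (CompleteSpace (UniformSpace.Completion (AlgPow H n)))

/-- The canonical isometric embedding of the algebraic tensor power in its completion. -/
def HilbertPow.ofAlg (n : ℕ) : AlgPow H n →ₗᵢ[ℂ] HilbertPow H n where
  toFun z := (z : UniformSpace.Completion (AlgPow H n))
  map_add' a b := UniformSpace.Completion.coe_add a b
  map_smul' c a := UniformSpace.Completion.coe_smul c a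
  norm_map' a := UniformSpace.Completion.norm_coe a

theorem HilbertPow.denseRange_ofAlg (n : ℕ) : DenseRange (HilbertPow.ofAlg (H := H) n) :=
  UniformSpace.Completion.denseRange_coe

theorem HilbertPow.induction {n : ℕ} {P : HilbertPow H n → Prop} (z : HilbertPow H n) (hc : IsClosed {z | P z})
    (h : ∀ a, P (HilbertPow.ofAlg n a)) : P z :=
  (HilbertPow.denseRange_ofAlg n).induction_on z hc h



theorem inner_form {n : ℕ} (z w : AlgPow H n) : inner ℂ z w = form n z w := rfl

/-- The simple tensor `x₁ ⊗ ⋯ ⊗ xₙ`. -/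
def HilbertPow.tprod {n : ℕ} (x : Fin n → H) : HilbertPow H n := HilbertPow.ofAlg n (algTprod x)

theorem HilbertPow.inner_tprod {n : ℕ} (x y : Fin n → H) :
    inner ℂ (HilbertPow.tprod x) (HilbertPow.tprod y) = ∏ k, inner ℂ (x k) (y k) := by
  rw [HilbertPow.tprod, HilbertPow.tprod, LinearIsometry.inner_map_map, inner_algTprod]

/-- Extension of a bounded operator from the algebraic tensor power by continuity. -/
def HilbertPow.lift {n : ℕ} {E : Type*} [NormedAddCommGroup E] [NormedSpace ℂ E] [CompleteSpace E]
    (f : AlgPow H n →L[ℂ] E) : HilbertPow H n →L[ℂ] E :=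
  f.extend (HilbertPow.ofAlg (H := H) n).toContinuousLinearMap

theorem HilbertPow.lift_coe {n : ℕ} {E : Type*} [NormedAddCommGroup E] [NormedSpace ℂ E]
    [CompleteSpace E] (f : AlgPow H n →L[ℂ] E) (z : AlgPow H n) :
    HilbertPow.lift f (HilbertPow.ofAlg n z) = f z :=
  f.extend_eq (e := (HilbertPow.ofAlg (H := H) n).toContinuousLinearMap)
    (HilbertPow.denseRange_ofAlg n) (HilbertPow.ofAlg (H := H) n).isometry.isUniformInducing z

theorem HilbertPow.hom_ext {n : ℕ} {E : Type*} [NormedAddCommGroup E] [NormedSpace ℂ E]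
    {f g : HilbertPow H n →L[ℂ] E}
    (h : ∀ x, f (HilbertPow.tprod x) = g (HilbertPow.tprod x)) : f = g := by
  ext z
  refine HilbertPow.induction z (isClosed_eq f.continuous g.continuous) fun a => ?_
  induction a using algPow_induction with
  | smul c x =>
    rw [map_smul, map_smul, map_smul]
    exact congrArg (c • ·) (h x)
  | add a b ha hb => rw [map_add, map_add, map_add, ha, hb]

/-- Permutation of tensor factors on the algebraic tensor power. -/
def algPerm {n : ℕ} (π : Equiv.Perm (Fin n)) : AlgPow H n →ₗ[ℂ] AlgPow H n :=
  (PiTensorProduct.reindex ℂ (fun _ : Fin n => H) π).toLinearMap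

theorem algPerm_tprod {n : ℕ} (π : Equiv.Perm (Fin n)) (x : Fin n → H) :
    algPerm π (algTprod x) = algTprod fun i => x (π.symm i) :=
  PiTensorProduct.reindex_tprod π x

theorem inner_algPerm {n : ℕ} (π : Equiv.Perm (Fin n)) (z w : AlgPow H n) :
    inner ℂ (algPerm π z) (algPerm π w) = inner ℂ z w := by
  induction z using algPow_induction with
  | add a b ha hb => simp only [map_add, inner_add_left, ha, hb]
  | smul c x =>
    induction w using algPow_induction with
    | add a b ha hb => simp only [map_add, inner_add_right, ha, hb]
    | smul d y =>
      simp only [map_smul, inner_smul_left, inner_smul_right, algPerm_tprod, inner_algTprod]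
      rw [Equiv.prod_comp π.symm fun i => inner ℂ (x i) (y i)]

/-- The unitary `U_π` with `U_π (x₁ ⊗ ⋯ ⊗ xₙ) = x_{π⁻¹(1)} ⊗ ⋯ ⊗ x_{π⁻¹(n)}`, see `permOp_tprod`. -/
def permOp {n : ℕ} (π : Equiv.Perm (Fin n)) : HilbertPow H n →L[ℂ] HilbertPow H n :=
  HilbertPow.lift ((HilbertPow.ofAlg n).toContinuousLinearMap ∘L
    ((algPerm π).isometryOfInner (inner_algPerm π)).toContinuousLinearMap)

theorem permOp_tprod {n : ℕ} (π : Equiv.Perm (Fin n)) (x : Fin n → H) :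
    permOp π (HilbertPow.tprod x) = HilbertPow.tprod fun i => x (π.symm i) := by
  rw [permOp, HilbertPow.tprod, HilbertPow.lift_coe]
  exact congrArg (HilbertPow.ofAlg n) (algPerm_tprod π x)

theorem permOp_mul {n : ℕ} (σ π : Equiv.Perm (Fin n)) :
    (permOp (σ * π) : HilbertPow H n →L[ℂ] HilbertPow H n) = permOp σ ∘L permOp π := by
  refine HilbertPow.hom_ext fun x => ?_
  simp only [ContinuousLinearMap.comp_apply, permOp_tprod]
  rfl

/-- The sign of a permutation as a complex number. -/
def sgn {n : ℕ} (π : Equiv.Perm (Fin n)) : ℂ := ((Equiv.Perm.sign π : ℤ) : ℂ)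

/-- The antisymmetrizer `Aₙ = (1 / n!) ∑_π sgn(π) U_π`. -/
def antisymmetrizer (H : Type*) [NormedAddCommGroup H] [InnerProductSpace ℂ H] (n : ℕ) :
    HilbertPow H n →L[ℂ] HilbertPow H n :=
  ((n.factorial : ℂ)⁻¹) • ∑ π : Equiv.Perm (Fin n), sgn π • permOp π

/-- The subspace of antisymmetric vectors, `U_π ψ = sgn(π) ψ` for all `π`. -/
def antisym (H : Type*) [NormedAddCommGroup H] [InnerProductSpace ℂ H] (n : ℕ) :
    Submodule ℂ (HilbertPow H n) where
  carrier := {ψ | ∀ π : Equiv.Perm (Fin n), permOp π ψ = sgn π • ψ}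
  add_mem' := fun ha hb π => by rw [map_add, ha π, hb π, smul_add]
  zero_mem' := fun π => by simp
  smul_mem' := fun c ψ h π => by rw [map_smul, h π, smul_comm]

theorem isClosed_antisym (n : ℕ) : IsClosed (antisym H n : Set (HilbertPow H n)) := by
  have : (antisym H n : Set (HilbertPow H n))
      = ⋂ π : Equiv.Perm (Fin n), {ψ | permOp π ψ = sgn π • ψ} := by
    ext ψ; simp [antisym]
  rw [this]
  exact isClosed_iInter fun π =>
    isClosed_eq (permOp π).continuous (continuous_const_smul _)

instance (n : ℕ) : CompleteSpace (antisym H n) := (isClosed_antisym n).completeSpace_coe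

theorem antisymmetrizer_mem {n : ℕ} (ψ : HilbertPow H n) : antisymmetrizer H n ψ ∈ antisym H n := by
  intro σ
  simp only [antisymmetrizer, smul_apply, map_smul,
    sum_apply, map_sum]
  rw [smul_comm (sgn σ) ((n.factorial : ℂ)⁻¹)]
  refine congrArg (((n.factorial : ℂ)⁻¹) • ·) ?_
  rw [Finset.smul_sum (r := sgn σ)]
  rw [← Equiv.sum_comp (Equiv.mulLeft σ) fun π => sgn σ • sgn π • permOp π ψ]
  refine Finset.sum_congr rfl fun π _ => ?_
  rw [Equiv.coe_mulLeft, permOp_mul, ContinuousLinearMap.comp_apply, smul_smul]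
  congr 1
  simp only [sgn, map_mul, Units.val_mul, Int.cast_mul, ← mul_assoc]
  rw [← Int.cast_mul, ← Units.val_mul, Int.units_mul_self]
  simp

/-- The algebraic tensor power of an operator. -/
def algMap {n : ℕ} (T : H →L[ℂ] H) : AlgPow H n →ₗ[ℂ] AlgPow H n :=
  PiTensorProduct.map fun _ => T.toLinearMap

theorem algMap_tprod {n : ℕ} (T : H →L[ℂ] H) (x : Fin n → H) :
    algMap T (algTprod x) = algTprod fun i => T (x i) :=
  PiTensorProduct.map_tprod _ x

theorem norm_algMap_le {n : ℕ} (T : H →L[ℂ] H) (z : AlgPow H n) :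
    ‖algMap T z‖ ≤ ‖T‖ ^ n * ‖z‖ := by
  refine le_of_sq_le_sq ?_ (by positivity)
  obtain ⟨N, c, x, rfl⟩ := exists_eq_sum z
  have h := (posSemidef_prod_sub (fun k => ‖T‖ ^ 2 • Matrix.gram ℂ (fun i => x i k))
    (fun k => Matrix.gram ℂ (fun i => T (x i k))) (fun k => Matrix.posSemidef_gram ℂ _)
    (fun k => Matrix.posSemidef_opNorm_smul_gram_sub_gram (fun i => x i k) T) Finset.univ).2
  have h' := (Complex.nonneg_iff.mp (h.dotProduct_mulVec_nonneg c)).1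
  have e1 : (Matrix.of fun i j => ∏ k, (‖T‖ ^ 2 • Matrix.gram ℂ (fun i => x i k)) i j)
      = ((‖T‖ ^ n) ^ 2) • prodGram x := by
    ext i j
    simp [prodGram, Matrix.gram, Finset.prod_mul_distrib]
    left; ring
  have e2 : (Matrix.of fun i j => ∏ k, (Matrix.gram ℂ (fun i => T (x i k))) i j)
      = prodGram fun i k => T (x i k) := rfl
  rw [e1, e2, Matrix.sub_mulVec, dotProduct_sub, Matrix.smul_mulVec, dotProduct_smul,
    ← form_sum_self, ← form_sum_self, Complex.sub_re, Complex.smul_re] at h'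
  rw [mul_pow, ← inner_self_eq_norm_sq (𝕜 := ℂ), ← inner_self_eq_norm_sq (𝕜 := ℂ), inner_form,
    inner_form]
  simp only [map_sum (algMap T), map_smul (algMap T), algMap_tprod]
  exact sub_nonneg.mp h'

/-- The tensor power `T ⊗ ⋯ ⊗ T` (`n` factors) of a bounded operator `T`, the bounded operator
with `x₁ ⊗ ⋯ ⊗ xₙ ↦ T x₁ ⊗ ⋯ ⊗ T xₙ`, see `tensorPow_tprod`. -/
def tensorPow (T : H →L[ℂ] H) (n : ℕ) : HilbertPow H n →L[ℂ] HilbertPow H n :=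
  HilbertPow.lift ((HilbertPow.ofAlg n).toContinuousLinearMap ∘L
    ((algMap T).mkContinuous (‖T‖ ^ n) (norm_algMap_le T)))

theorem tensorPow_tprod (T : H →L[ℂ] H) {n : ℕ} (x : Fin n → H) :
    tensorPow T n (HilbertPow.tprod x) = HilbertPow.tprod fun i => T (x i) := by
  rw [tensorPow, HilbertPow.tprod, HilbertPow.lift_coe]
  exact congrArg (HilbertPow.ofAlg n) (algMap_tprod T x)

/-- The tensor product of an `m`-fold and a `k`-fold tensor, algebraically. -/
def algMul (m k : ℕ) : AlgPow H m →ₗ[ℂ] AlgPow H k →ₗ[ℂ] AlgPow H (m + k) :=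
  (TensorProduct.mk ℂ (PiTensorProduct ℂ (fun _ : Fin m => H))
    (PiTensorProduct ℂ (fun _ : Fin k => H))).compr₂
    (TensorPower.mulEquiv (R := ℂ) (M := H) (n := m) (m := k)).toLinearMap

theorem algMul_tprod {m k : ℕ} (x : Fin m → H) (y : Fin k → H) :
    algMul m k (algTprod x) (algTprod y) = algTprod (Fin.append x y) :=
  TensorPower.tprod_mul_tprod ℂ x y

theorem inner_algMul {m k : ℕ} (a a' : AlgPow H m) (b b' : AlgPow H k) :
    inner ℂ (algMul m k a b) (algMul m k a' b') = inner ℂ a a' * inner ℂ b b' := by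
  induction a using algPow_induction with
  | add _ _ h₁ h₂ => simp only [map_add, LinearMap.add_apply, inner_add_left, h₁, h₂, add_mul]
  | smul c x =>
  induction a' using algPow_induction with
  | add _ _ h₁ h₂ =>
    simp only [map_add, LinearMap.add_apply, inner_add_right, h₁, h₂, add_mul]
  | smul c' x' =>
  induction b using algPow_induction with
  | add _ _ h₁ h₂ => simp only [map_add, inner_add_left, h₁, h₂, mul_add]
  | smul d y =>
  induction b' using algPow_induction with
  | add _ _ h₁ h₂ => simp only [map_add, inner_add_right, h₁, h₂, mul_add]
  | smul d' y' =>
  simp only [map_smul, LinearMap.smul_apply, inner_smul_left, inner_smul_right, algMul_tprod,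
    inner_algTprod, Fin.prod_univ_add, Fin.append_left, Fin.append_right]
  ring

theorem norm_algMul {m k : ℕ} (a : AlgPow H m) (b : AlgPow H k) :
    ‖algMul m k a b‖ = ‖a‖ * ‖b‖ := by
  have h := inner_algMul a a b b
  simp only [inner_self_eq_norm_sq_to_K] at h
  have h' : ‖algMul m k a b‖ ^ 2 = (‖a‖ * ‖b‖) ^ 2 := by
    rw [mul_pow]; exact_mod_cast h
  exact (sq_eq_sq₀ (norm_nonneg _) (by positivity)).mp h'

/-- `algMul` as a bounded bilinear map into the completion. -/
def algMulL (m k : ℕ) : AlgPow H m →L[ℂ] AlgPow H k →L[ℂ] HilbertPow H (m + k) :=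
  ((algMul m k).compr₂ (HilbertPow.ofAlg (m + k)).toLinearMap
    ).mkContinuous₂ 1 fun a b => by
      rw [one_mul, ← norm_algMul]
      exact ((HilbertPow.ofAlg (m + k)).norm_map _).le

/-- `algMulL`, extended by continuity in the second variable. -/
def mulAux (m k : ℕ) : AlgPow H m →ₗ[ℂ] HilbertPow H k →L[ℂ] HilbertPow H (m + k) where
  toFun a := HilbertPow.lift (algMulL m k a)
  map_add' a a' := HilbertPow.hom_ext fun x => by
    simp only [HilbertPow.tprod, HilbertPow.lift_coe, map_add, add_apply]
  map_smul' c a := HilbertPow.hom_ext fun x => by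
    simp only [HilbertPow.tprod, HilbertPow.lift_coe, map_smul, smul_apply, RingHom.id_apply]

theorem norm_mulAux_le {m k : ℕ} (a : AlgPow H m) : ‖mulAux (H := H) m k a‖ ≤ 1 * ‖a‖ := by
  rw [one_mul]
  refine ContinuousLinearMap.opNorm_le_bound _ (norm_nonneg _) fun z => ?_
  induction z using HilbertPow.induction with
  | hc => exact isClosed_le (by fun_prop) (by fun_prop)
  | h b =>
    change ‖HilbertPow.lift (algMulL m k a) (HilbertPow.ofAlg k b)‖ ≤ _
    rw [HilbertPow.lift_coe, LinearIsometry.norm_map, ← norm_algMul]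
    exact ((HilbertPow.ofAlg (m + k)).norm_map _).le

/-- The tensor product `a ⊗ b` of an `m`-fold tensor `a` and a `k`-fold tensor `b`, as an
`(m + k)`-fold tensor. -/
def HilbertPow.mul (m k : ℕ) : HilbertPow H m →L[ℂ] HilbertPow H k →L[ℂ] HilbertPow H (m + k) :=
  HilbertPow.lift ((mulAux m k).mkContinuous 1 norm_mulAux_le)

theorem HilbertPow.mul_coe {m k : ℕ} (a : AlgPow H m) (b : AlgPow H k) :
    HilbertPow.mul m k (HilbertPow.ofAlg m a) (HilbertPow.ofAlg k b) = HilbertPow.ofAlg (m + k) (algMul m k a b) := by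
  rw [HilbertPow.mul, HilbertPow.lift_coe]
  change HilbertPow.lift (algMulL m k a) (HilbertPow.ofAlg k b) = _
  rw [HilbertPow.lift_coe]
  rfl

theorem HilbertPow.mul_tprod {m k : ℕ} (x : Fin m → H) (y : Fin k → H) :
    HilbertPow.mul m k (HilbertPow.tprod x) (HilbertPow.tprod y) = HilbertPow.tprod (Fin.append x y) := by
  rw [HilbertPow.tprod, HilbertPow.tprod, HilbertPow.mul_coe, algMul_tprod]; rfl

theorem HilbertPow.inner_mul {m k : ℕ} (a a' : HilbertPow H m) (b b' : HilbertPow H k) :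
    inner ℂ (HilbertPow.mul m k a b) (HilbertPow.mul m k a' b') = inner ℂ a a' * inner ℂ b b' := by
  induction a using HilbertPow.induction with
  | hc => exact isClosed_eq (by fun_prop) (by fun_prop)
  | h a =>
  induction a' using HilbertPow.induction with
  | hc => exact isClosed_eq (by fun_prop) (by fun_prop)
  | h a' =>
  induction b using HilbertPow.induction with
  | hc => exact isClosed_eq (by fun_prop) (by fun_prop)
  | h b =>
  induction b' using HilbertPow.induction with
  | hc => exact isClosed_eq (by fun_prop) (by fun_prop)
  | h b' =>
  simp only [HilbertPow.mul_coe, LinearIsometry.inner_map_map, inner_algMul]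

/-- `a ⊗ b ↦ a ⊗ b` as an isometry, with dense range, of the tensor product of an `m`-fold and a
`k`-fold tensor power into the `(m + k)`-fold one. -/
def HilbertPow.mulₗᵢ (m k : ℕ) : HilbertPow H m ⊗[ℂ] HilbertPow H k →ₗᵢ[ℂ] HilbertPow H (m + k) :=
  (TensorProduct.lift (HilbertPow.mul (H := H) m k).toLinearMap₁₂).isometryOfInner fun z w => by
    induction z using TensorProduct.induction_on with
    | zero => simp
    | add _ _ h₁ h₂ => simp only [map_add, inner_add_left, h₁, h₂]
    | tmul a b =>
      induction w using TensorProduct.induction_on with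
      | zero => simp
      | add _ _ h₁ h₂ => simp only [map_add, inner_add_right, h₁, h₂]
      | tmul a' b' =>
        simp only [TensorProduct.lift.tmul, TensorProduct.inner_tmul]
        exact HilbertPow.inner_mul a a' b b'

theorem HilbertPow.mulₗᵢ_tmul {m k : ℕ} (a : HilbertPow H m) (b : HilbertPow H k) :
    HilbertPow.mulₗᵢ m k (a ⊗ₜ[ℂ] b) = HilbertPow.mul m k a b := rfl

theorem HilbertPow.denseRange_mulₗᵢ (m k : ℕ) : DenseRange (HilbertPow.mulₗᵢ (H := H) m k) := by
  have h : ∀ z : AlgPow H (m + k), HilbertPow.ofAlg (m + k) z ∈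
      (HilbertPow.mulₗᵢ (H := H) m k).toLinearMap.range := by
    intro z
    induction z using algPow_induction with
    | add a b ha hb => rw [map_add]; exact Submodule.add_mem _ ha hb
    | smul c x =>
      rw [map_smul]
      refine Submodule.smul_mem _ c ⟨HilbertPow.tprod (fun i => x (Fin.castAdd k i)) ⊗ₜ[ℂ]
        HilbertPow.tprod (fun i => x (Fin.natAdd m i)), ?_⟩
      refine (HilbertPow.mul_tprod _ _).trans ?_
      rw [Fin.append_castAdd_natAdd]
      rfl
  refine (HilbertPow.denseRange_ofAlg (m + k)).mono ?_
  rintro _ ⟨z, rfl⟩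
  exact h z

/-- The operator `B ⊗ I ⊗ ⋯ ⊗ I` (`k` factors `I`): the bounded operator with
`a ⊗ b ↦ B a ⊗ b`, see `ampliate_mul`. -/
def ampliate {m : ℕ} (B : HilbertPow H m →L[ℂ] HilbertPow H m) (k : ℕ) :
    HilbertPow H (m + k) →L[ℂ] HilbertPow H (m + k) :=
  ((HilbertPow.mulₗᵢ m k).toContinuousLinearMap ∘L B.rTensor (HilbertPow H k)).extend
    (HilbertPow.mulₗᵢ (H := H) m k).toContinuousLinearMap

theorem ampliate_mul {m k : ℕ} (B : HilbertPow H m →L[ℂ] HilbertPow H m) (a : HilbertPow H m) (b : HilbertPow H k) :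
    ampliate B k (HilbertPow.mul m k a b) = HilbertPow.mul m k (B a) b :=
  ContinuousLinearMap.extend_eq _ (e := (HilbertPow.mulₗᵢ (H := H) m k).toContinuousLinearMap)
    (HilbertPow.denseRange_mulₗᵢ m k) (HilbertPow.mulₗᵢ (H := H) m k).isometry.isUniformInducing (a ⊗ₜ[ℂ] b)


/-! ### Hilbert space trace -/

section Trace

variable (K : Type*) [NormedAddCommGroup K] [InnerProductSpace ℂ K] [CompleteSpace K]

/-- An operator `T` is trace class if `|T| = √(T* T)` has finite trace (in every orthonormal
basis, equivalently in one). -/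
def IsTraceClass {K : Type*} [NormedAddCommGroup K] [InnerProductSpace ℂ K] [CompleteSpace K]
    (T : K →L[ℂ] K) : Prop :=
  ∀ (w : Set K) (b : HilbertBasis w ℂ K), Summable fun i => (inner ℂ (b i) (CFC.abs T (b i))).re

/-- Index set of some fixed orthonormal basis of `K`. -/
def basisIndex : Set K := (exists_hilbertBasis ℂ K).choose

/-- Some fixed orthonormal basis of `K`. -/
def someBasis : HilbertBasis (basisIndex K) ℂ K := (exists_hilbertBasis ℂ K).choose_spec.choose

/-- The trace `Tr T = ∑ᵢ ⟪bᵢ, T bᵢ⟫`; for trace class `T` the basis does not matter. -/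
def trace {K : Type*} [NormedAddCommGroup K] [InnerProductSpace ℂ K] [CompleteSpace K]
    (T : K →L[ℂ] K) : ℂ :=
  ∑' i, inner ℂ (someBasis K i) (T (someBasis K i))

/-- Density operators: nonnegative trace class operators of unit trace. -/
def IsDensityOperator {K : Type*} [NormedAddCommGroup K] [InnerProductSpace ℂ K] [CompleteSpace K]
    (D : K →L[ℂ] K) : Prop :=
  D.IsPositive ∧ IsTraceClass D ∧ trace D = 1

end Trace

/-! ### Partial traces -/

/-- The extension of an operator `A` on the antisymmetric subspace to the whole tensor power:
project onto the antisymmetric subspace, then apply `A`; that is `A ⊕ 0`. -/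
def extendByZero {n : ℕ} (A : antisym H n →L[ℂ] antisym H n) : HilbertPow H n →L[ℂ] HilbertPow H n :=
  (antisym H n).subtypeL ∘L A ∘L (antisym H n).orthogonalProjectionOnto

/-- `S` is the partial trace (reduction to `m` particles) of the operator `T` on the
`(m + k)`-particle space: `Tr ((B̄ ⊗ I ⊗ ⋯ ⊗ I) T̄) = Tr (B S)` for all compact Hermitian `B` on the
`m`-particle space, where the bar is `extendByZero`. This determines `S`. -/
def IsPartialTrace (m k : ℕ) (T : antisym H (m + k) →L[ℂ] antisym H (m + k))
    (S : antisym H m →L[ℂ] antisym H m) : Prop :=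
  IsTraceClass S ∧
    ∀ B : antisym H m →L[ℂ] antisym H m, IsCompactOperator B → IsSelfAdjoint B →
      trace (ampliate (extendByZero B) k ∘L extendByZero T) = trace (B ∘L S)

open scoped Classical in
/-- The partial trace of `T`, reducing `m + k` particles to `m` particles (`0` if there is none,
which does not happen for trace class `T`). -/
def partialTrace (m k : ℕ) (T : antisym H (m + k) →L[ℂ] antisym H (m + k)) :
    antisym H m →L[ℂ] antisym H m :=
  if h : ∃ S, IsPartialTrace m k T S then h.choose else 0

/-! ### Fock space and reduced number densities -/

/-- The fermion Fock space: the Hilbert space direct sum of all antisymmetric subspaces. -/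
abbrev Fock (H : Type*) [NormedAddCommGroup H] [InnerProductSpace ℂ H] : Type _ :=
  lp (fun n : ℕ => antisym H n) 2

/-- The graph of the (unbounded) number operator `N`: `ψ` is in its domain and `N ψ = χ`. -/
def IsNumberOp (ψ χ : Fock H) : Prop := ∀ n, χ n = (n : ℂ) • ψ n

/-- `D` commutes with the number operator `N`: it maps the domain of `N` to itself and
`N D ψ = D N ψ` on it. -/
def CommutesWithNumber (D : Fock H →L[ℂ] Fock H) : Prop :=
  ∀ ψ χ, IsNumberOp ψ χ → IsNumberOp (D ψ) (D χ)

/-- The `n`-particle component `Dₙ` of `D = ⨁ Dₙ`. -/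
def component (D : Fock H →L[ℂ] Fock H) (n : ℕ) : antisym H n →L[ℂ] antisym H n :=
  lp.evalCLM ℂ (fun n : ℕ => antisym H n) 2 n ∘L D ∘L
    lp.singleContinuousLinearMap ℂ (fun n : ℕ => antisym H n) 2 n

/-- `∑ₙ nᵐ Tr Dₙ < ∞`. -/
def FiniteMoment (m : ℕ) (D : Fock H →L[ℂ] Fock H) : Prop :=
  Summable fun n : ℕ => (n : ℝ) ^ m * (trace (component D n)).re

/-- The term `(n! / (n - m)!) D_{n:m}` with `n = m + k`. -/
def reducedSummand (m : ℕ) (D : Fock H →L[ℂ] Fock H) (k : ℕ) :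
    antisym H m →L[ℂ] antisym H m :=
  (((m + k).factorial : ℂ) / (k.factorial : ℂ)) • partialTrace m k (component D (m + k))

/-- The reduced number density of order `m`: the sum over `n ≥ m` of `(n! / (n - m)!) D_{n:m}`. -/
def reducedNumberDensity (m : ℕ) (D : Fock H →L[ℂ] Fock H) : antisym H m →L[ℂ] antisym H m :=
  ∑' k, reducedSummand m D k

/-- The reduced number density of order `m` of `D` is well defined: all partial traces exist, the
series converges, and its sum is trace class. -/
structure ReducedNumberDensityExists (m : ℕ) (D : Fock H →L[ℂ] Fock H) : Prop where
  isPartialTrace : ∀ k, IsPartialTrace m k (component D (m + k))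
    (partialTrace m k (component D (m + k)))
  hasSum : HasSum (reducedSummand m D) (reducedNumberDensity m D)
  isTraceClass : IsTraceClass (reducedNumberDensity m D)

/-! ### The one-particle space -/

theorem tprod_one_mem (x : H) : HilbertPow.tprod (fun _ : Fin 1 => x) ∈ antisym H 1 := by
  intro π
  rw [permOp_tprod, Subsingleton.elim π 1]
  simp [sgn]

/-- The canonical isometry of `H` into its first tensor power. -/
def oneParticleₗᵢ : H →ₗᵢ[ℂ] antisym H 1 :=
  LinearMap.isometryOfInner
    { toFun := fun x => ⟨HilbertPow.tprod fun _ => x, tprod_one_mem x⟩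
      map_add' := fun x y => Subtype.ext <| by
        have h := (PiTensorProduct.tprod ℂ (s := fun _ : Fin 1 => H)).map_update_add
          (fun _ => 0) 0 x y
        have u : ∀ z : H, Function.update (fun _ : Fin 1 => (0 : H)) 0 z = fun _ => z := by
          intro z; funext i; rw [Subsingleton.elim i 0]; simp
        simp only [u] at h
        exact (congrArg (HilbertPow.ofAlg 1) h).trans (map_add (HilbertPow.ofAlg 1) _ _)
      map_smul' := fun c x => Subtype.ext <| by
        have h := (PiTensorProduct.tprod ℂ (s := fun _ : Fin 1 => H)).map_update_smul
          (fun _ => 0) 0 c x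
        have u : ∀ z : H, Function.update (fun _ : Fin 1 => (0 : H)) 0 z = fun _ => z := by
          intro z; funext i; rw [Subsingleton.elim i 0]; simp
        simp only [u] at h
        exact (congrArg (HilbertPow.ofAlg 1) h).trans (map_smul (HilbertPow.ofAlg 1) _ _) }
    fun x y => by
      change inner ℂ (HilbertPow.tprod fun _ : Fin 1 => x) (HilbertPow.tprod fun _ : Fin 1 => y) = _
      rw [HilbertPow.inner_tprod]; simp

theorem oneParticleₗᵢ_surjective [CompleteSpace H] :
    Function.Surjective (oneParticleₗᵢ (H := H)) := by
  have hclosed : IsClosed (Set.range ((antisym H 1).subtypeₗᵢ.comp (oneParticleₗᵢ (H := H)))) :=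
    (LinearIsometry.isometry _).isClosedEmbedding.isClosed_range
  have hmem : ∀ z : HilbertPow H 1,
      z ∈ Set.range ((antisym H 1).subtypeₗᵢ.comp (oneParticleₗᵢ (H := H))) := by
    intro z
    induction z using HilbertPow.induction with
    | hc => exact hclosed
    | h a =>
      induction a using algPow_induction with
      | add a b ha hb =>
        obtain ⟨x, hx⟩ := ha
        obtain ⟨y, hy⟩ := hb
        exact ⟨x + y, by rw [map_add, map_add, hx, hy]⟩
      | smul c x =>
        refine ⟨c • x 0, ?_⟩
        rw [map_smul, map_smul]
        refine congrArg (fun y : Fin 1 → H => c • HilbertPow.tprod y) ?_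
        funext i
        rw [Subsingleton.elim i 0]
  intro ψ
  obtain ⟨x, hx⟩ := hmem ψ
  exact ⟨x, Subtype.ext hx⟩

/-- The canonical identification of `H` with the one-particle space, its first tensor power. -/
def oneParticle (H : Type*) [NormedAddCommGroup H] [InnerProductSpace ℂ H] [CompleteSpace H] :
    H ≃ₗᵢ[ℂ] antisym H 1 :=
  LinearIsometryEquiv.ofSurjective oneParticleₗᵢ oneParticleₗᵢ_surjective

/-- An operator on the one-particle space, as an operator on `H`. -/
def oneParticleOp [CompleteSpace H] (B : antisym H 1 →L[ℂ] antisym H 1) : H →L[ℂ] H :=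
  (oneParticle H).symm.toContinuousLinearEquiv.toContinuousLinearMap ∘L B ∘L
    (oneParticle H).toContinuousLinearEquiv.toContinuousLinearMap

/-! ### Mixtures of Slater determinants -/

/-- The vector `√(n!) Aₙ (x₁ ⊗ ⋯ ⊗ xₙ)`, a Slater determinant if `x` is orthonormal. -/
def slater {n : ℕ} (x : Fin n → H) : antisym H n :=
  ⟨(Real.sqrt n.factorial : ℂ) • antisymmetrizer H n (HilbertPow.tprod x),
    (antisym H n).smul_mem _ (antisymmetrizer_mem _)⟩

/-- The vector `Ψ(s)` of Fock space for a finite set `s` of indices: the Slater determinant of the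
`φ j`, `j ∈ s`, in the order chosen by `e`. For `s = ∅` it is the vacuum vector. -/
def slaterFock {J : Type*} (φ : J → H) (e : ∀ s : Finset J, Fin s.card ≃ s) (s : Finset J) :
    Fock H :=
  lp.single 2 s.card (slater fun i => φ (e s i))

/-- The operator `∑ₛ P(s) P_s`, where `P_s` is the orthogonal projector onto the span of `Ψ(s)`. -/
def slaterMixture {J : Type*} (φ : J → H) (e : ∀ s : Finset J, Fin s.card ≃ s)
    (P : PMF (Finset J)) : Fock H →L[ℂ] Fock H :=
  ∑' s, ((P s).toReal : ℂ) • (Submodule.span ℂ {slaterFock φ e s}).starProjection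

open scoped Classical in
/-- The occupation number `N_j(s)`: `1` if `j ∈ s`, else `0`. -/
def occupation {J : Type*} (j : J) (s : Finset J) : ℕ := if j ∈ s then 1 else 0

/-- The occupation numbers are independent under `P`, for the σ-algebra of all subsets. -/
def IndependentOccupations {J : Type*} (P : PMF (Finset J)) : Prop :=
  ProbabilityTheory.iIndepFun (_mΩ := ⊤) (fun j : J => occupation j)
    (@PMF.toMeasure (Finset J) ⊤ P)

end FermiFock

end

noncomputable section

open scoped InnerProductSpace TensorProduct ComplexOrder

namespace FermiFock

variable {H : Type*} [NormedAddCommGroup H] [InnerProductSpace ℂ H]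

/-! ### Traces of norm convergent sums of operators of rank one -/

section Nuclear

open InnerProductSpace

variable {K : Type*} [NormedAddCommGroup K] [InnerProductSpace ℂ K]

/-! Write p_j for the probability that j is occupied (`occProb`). Reducing the pure state Ψ(s), |s|
= n, to m particles gives the uniform mixture of the Ψ(t) over the t ⊆ s with |t| = m
(`inner_slaterVec_ampliate`): after expanding both Slater vectors into permuted simple tensors,
orthonormality of the n - m traced factors kills all pairs of permutations that disagree there. Each
t gets weight m!(n-m)!/n!, and the factor n!/(n-m)! in the reduced number density turns this into
m!, which no longer depends on n. Hence the density of order m is m! ∑ Prob(t ⊆ s) |Ψ(t)⟩⟨Ψ(t)|,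
summed over |t| = m, and independence gives Prob(t ⊆ s) = ∏_{j ∈ t} p_j (`hasSum_reducedSummand`).

This operator is diagonal in the Slater basis. For m = 1 it multiplies φ_j by p_j, so on a simple
tensor of basis vectors both sides of the identity yield n! ∏ p_j times its antisymmetrization
(`extendByZero_occupationDensity`); such tensors determine a bounded operator
(`HilbertPow.hom_ext_hilbertBasis`).

Convergence rests on ∑ p_j < ∞, a Borel–Cantelli argument: the random set is finite and the
occupations are independent (`IndependentOccupations.summable_occProb`). Then ∑_t ∏_{j ∈ t} p_j = ∏
(1 + p_j) is finite, so the weights P(s) on pairs t ⊆ s are summable. Summed by s they give a finite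
mean of 2^|s|, hence all moments; summed by t, or by |s| - m, they justify the rearrangements above.
Every operator involved is a norm convergent series of rank one operators with summable nonnegative
weights (`IsMixture`), so positivity, trace class and traces are read off termwise. -/

theorem summable_norm_inner_mul_inner {w : Type*} (b : HilbertBasis w ℂ K) (x y : K) :
    Summable fun i => ‖inner ℂ x (b i) * inner ℂ (b i) y‖ :=
  (b.summable_inner_mul_inner x y).norm

theorem tsum_norm_inner_mul_inner_self {w : Type*} (b : HilbertBasis w ℂ K) (x : K) :
    ∑' i, ‖inner ℂ x (b i) * inner ℂ (b i) x‖ = ‖x‖ ^ 2 := by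
  have h := (b.hasSum_inner_mul_inner x x).mapL Complex.reCLM
  have e : ∀ i, Complex.reCLM (inner ℂ x (b i) * inner ℂ (b i) x)
      = ‖inner ℂ x (b i) * inner ℂ (b i) x‖ := fun i => by
    rw [← inner_conj_symm x (b i), Complex.conj_mul', ← Complex.ofReal_pow, Complex.norm_real,
      Real.norm_of_nonneg (by positivity), Complex.reCLM_apply, Complex.ofReal_re]
  simp only [e] at h
  rw [h.tsum_eq]
  exact inner_self_eq_norm_sq (𝕜 := ℂ) x

/-- The diagonal of a norm convergent sum of operators of rank one, in any orthonormal basis. -/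
theorem hasSum_inner_of_hasSum_rankOne {ι w : Type*} (b : HilbertBasis w ℂ K) {c : ι → ℂ}
    {u v : ι → K} {C : ℝ} (hc : Summable fun s => ‖c s‖) (hu : ∀ s, ‖u s‖ ≤ C) (hv : ∀ s, ‖v s‖ ≤ C)
    {T : K →L[ℂ] K} (hT : HasSum (fun s => c s • rankOne ℂ (u s) (v s)) T) :
    HasSum (fun i => inner ℂ (b i) (T (b i))) (∑' s, c s * inner ℂ (v s) (u s)) := by
  set F : ι × w → ℂ := fun q => c q.1 * (inner ℂ (v q.1) (b q.2) * inner ℂ (b q.2) (u q.1)) with hF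
  have hrow : ∀ s, HasSum (fun i => F (s, i)) (c s * inner ℂ (v s) (u s)) := fun s =>
    (b.hasSum_inner_mul_inner (v s) (u s)).mul_left (c s)
  have hnorm : ∀ s, Summable fun i => ‖F (s, i)‖ := fun s => (hrow s).summable.norm
  -- By AM-GM and Parseval each row has absolute sum at most `‖c s‖ * C ^ 2`, so the double series
  -- converges absolutely and may be summed in either order.
  have hbound : ∀ s, ∑' i, ‖F (s, i)‖ ≤ ‖c s‖ * C ^ 2 := by
    intro s
    have hle : ∀ i, ‖F (s, i)‖ ≤ ‖c s‖ * ((‖inner ℂ (v s) (b i) * inner ℂ (b i) (v s)‖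
        + ‖inner ℂ (u s) (b i) * inner ℂ (b i) (u s)‖) / 2) := by
      intro i
      rw [hF, norm_mul]
      refine mul_le_mul_of_nonneg_left ?_ (norm_nonneg _)
      simp only [norm_mul, norm_inner_symm (b i) (v s), norm_inner_symm (b i) (u s)]
      nlinarith [sq_nonneg (‖inner ℂ (v s) (b i)‖ - ‖inner ℂ (u s) (b i)‖)]
    have hs := ((summable_norm_inner_mul_inner b (v s) (v s)).add
      (summable_norm_inner_mul_inner b (u s) (u s))).div_const 2 |>.mul_left ‖c s‖
    refine ((hnorm s).tsum_le_tsum hle hs).trans ?_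
    rw [tsum_mul_left, tsum_div_const, (summable_norm_inner_mul_inner b (v s) (v s)).tsum_add
      (summable_norm_inner_mul_inner b (u s) (u s)), tsum_norm_inner_mul_inner_self,
      tsum_norm_inner_mul_inner_self]
    refine mul_le_mul_of_nonneg_left ?_ (norm_nonneg _)
    have := pow_le_pow_left₀ (norm_nonneg _) (hu s) 2
    have := pow_le_pow_left₀ (norm_nonneg _) (hv s) 2
    linarith
  have hsum : Summable F := by
    refine Summable.of_norm ((summable_prod_of_nonneg fun _ => norm_nonneg _).2 ⟨hnorm, ?_⟩)
    exact (hc.mul_right (C ^ 2)).of_nonneg_of_le (fun s => tsum_nonneg fun _ => norm_nonneg _) hbound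
  have h1 : HasSum F (∑' s, c s * inner ℂ (v s) (u s)) := by
    have := hsum.hasSum
    rwa [(this.prod_fiberwise hrow).tsum_eq]
  -- In the other order, the sum over `s` for fixed `i` is the diagonal entry of `T` at `b i`.
  have h2 := ((Equiv.prodComm w ι).hasSum_iff (f := F)).2 h1
  refine h2.prod_fiberwise fun i => ?_
  have h3 := (hT.mapL (ContinuousLinearMap.apply ℂ K (b i))).mapL (innerSL ℂ (b i))
  simp only [ContinuousLinearMap.apply_apply, smul_apply, rankOne_apply, innerSL_apply_apply,
    inner_smul_right] at h3
  simpa [F, Function.comp_def, mul_comm, mul_left_comm, mul_assoc] using h3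

/-- A representation of `T` as a norm convergent mixture of the operators `|uₛ⟩⟨uₛ|` with
nonnegative summable weights `rₛ`, where `‖uₛ‖ ≤ 1`. -/
structure IsMixture {ι : Type*} (r : ι → ℝ) (u : ι → K) (T : K →L[ℂ] K) : Prop where
  nonneg : ∀ s, 0 ≤ r s
  summable : Summable r
  norm_le : ∀ s, ‖u s‖ ≤ 1
  hasSum : HasSum (fun s => (r s : ℂ) • rankOne ℂ (u s) (u s)) T

theorem summable_smul_rankOne [CompleteSpace K] {ι : Type*} {r : ι → ℝ} {u : ι → K} (h0 : ∀ s, 0 ≤ r s)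
    (hr : Summable r) (hu : ∀ s, ‖u s‖ ≤ 1) :
    Summable fun s => (r s : ℂ) • rankOne ℂ (u s) (u s) := by
  refine Summable.of_norm_bounded hr fun s => ?_
  rw [norm_smul, norm_rankOne, Complex.norm_real, Real.norm_of_nonneg (h0 s)]
  exact mul_le_of_le_one_right (h0 s) (mul_le_one₀ (hu s) (norm_nonneg _) (hu s))

theorem isMixture_tsum [CompleteSpace K] {ι : Type*} {r : ι → ℝ} {u : ι → K} (h0 : ∀ s, 0 ≤ r s)
    (hr : Summable r) (hu : ∀ s, ‖u s‖ ≤ 1) :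
    IsMixture r u (∑' s, (r s : ℂ) • rankOne ℂ (u s) (u s)) :=
  ⟨h0, hr, hu, (summable_smul_rankOne h0 hr hu).hasSum⟩

theorem trace_of_hasSum_rankOne [CompleteSpace K] {ι : Type*} {c : ι → ℂ} {u v : ι → K} {C : ℝ}
    (hc : Summable fun s => ‖c s‖) (hu : ∀ s, ‖u s‖ ≤ C) (hv : ∀ s, ‖v s‖ ≤ C)
    {T : K →L[ℂ] K} (hT : HasSum (fun s => c s • rankOne ℂ (u s) (v s)) T) :
    trace T = ∑' s, c s * inner ℂ (v s) (u s) :=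
  (hasSum_inner_of_hasSum_rankOne (someBasis K) hc hu hv hT).tsum_eq

namespace IsMixture

variable {ι : Type*} {r : ι → ℝ} {u : ι → K} {T : K →L[ℂ] K}

theorem summable_norm (h : IsMixture r u T) : Summable fun s => ‖(r s : ℂ)‖ := by
  simpa using h.summable.norm

variable [CompleteSpace K]

theorem isPositive (h : IsMixture r u T) : T.IsPositive := by
  refine (ContinuousLinearMap.nonneg_iff_isPositive T).1 (h.hasSum.nonneg fun s => ?_)
  exact (ContinuousLinearMap.nonneg_iff_isPositive _).2
    ((isPositive_rankOne_self (u s)).smul_of_nonneg (Complex.zero_le_real.2 (h.nonneg s)))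

/-- Positivity gives |T| = T, and the diagonal of a mixture is summable in every orthonormal basis.
-/
theorem isTraceClass (h : IsMixture r u T) : IsTraceClass T := by
  intro w b
  rw [CFC.abs_of_nonneg T ((ContinuousLinearMap.nonneg_iff_isPositive T).2 h.isPositive)]
  exact ((hasSum_inner_of_hasSum_rankOne b h.summable_norm h.norm_le h.norm_le h.hasSum).mapL
    Complex.reCLM).summable

theorem trace_comp (h : IsMixture r u T) (B : K →L[ℂ] K) :
    trace (B ∘L T) = ∑' s, (r s : ℂ) * inner ℂ (u s) (B (u s)) := by
  have hB := h.hasSum.mapL (ContinuousLinearMap.compL ℂ K K K B)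
  simp only [map_smul, ContinuousLinearMap.compL_apply, comp_rankOne] at hB
  -- `1 + ‖B‖` bounds both families of vectors at once: `B (u s)` by `‖B‖` and `u s` by 1.
  refine trace_of_hasSum_rankOne (C := 1 + ‖B‖) h.summable_norm (fun s => ?_) (fun s => ?_) hB
  · have := B.le_opNorm_of_le (h.norm_le s)
    linarith
  · linarith [h.norm_le s, norm_nonneg B]

theorem trace_eq (h : IsMixture r u T) : trace T = ∑' s, (r s : ℂ) * (‖u s‖ : ℂ) ^ 2 := by
  have := h.trace_comp (ContinuousLinearMap.id ℂ K)
  simpa [inner_self_eq_norm_sq_to_K] using this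

end IsMixture

variable [CompleteSpace K]

/-- The product is |v⟩⟨S* v|, so this is Parseval's identity. -/
theorem trace_rankOne_comp (v : K) (S : K →L[ℂ] K) :
    trace (rankOne ℂ v v ∘L S) = inner ℂ v (S v) := by
  rw [rankOne_comp, trace, ← ContinuousLinearMap.adjoint_inner_left,
    ← (someBasis K).tsum_inner_mul_inner]
  refine tsum_congr fun i => ?_
  rw [rankOne_apply, inner_smul_right]

omit [CompleteSpace K] in
theorem isCompactOperator_rankOne (u v : K) : IsCompactOperator (rankOne ℂ u v) := by
  rw [rankOne_def']
  have h : IsCompactOperator (ContinuousLinearMap.toSpanSingleton ℂ u) :=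
    isCompactOperator_of_locallyCompactSpace_rng _
  exact h.comp_clm _

end Nuclear

/-! ### Uniqueness of the partial trace -/

/-- The test operators |v⟩⟨v| are compact and Hermitian and recover the quadratic form, which
determines an operator on a complex space by polarization. -/
theorem IsPartialTrace.unique {m k : ℕ} {T : antisym H (m + k) →L[ℂ] antisym H (m + k)}
    {S S' : antisym H m →L[ℂ] antisym H m} (h : IsPartialTrace m k T S)
    (h' : IsPartialTrace m k T S') : S = S' := by
  refine ContinuousLinearMap.coe_injective ((ext_inner_map _ _).1 fun v => ?_)
  have hB : IsSelfAdjoint (InnerProductSpace.rankOne ℂ v v) :=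
    (InnerProductSpace.isPositive_rankOne_self v).isSelfAdjoint
  have := (h.2 _ (isCompactOperator_rankOne v v) hB).symm.trans
    (h'.2 _ (isCompactOperator_rankOne v v) hB)
  rw [trace_rankOne_comp, trace_rankOne_comp] at this
  -- `ext_inner_map` has the operator in the first slot of the inner product, the trace formula in
  -- the second; conjugation switches them.
  exact (inner_conj_symm _ _).symm.trans
    ((congrArg (starRingEnd ℂ) this).trans (inner_conj_symm _ _))

theorem IsPartialTrace.partialTrace_eq {m k : ℕ}
    {T : antisym H (m + k) →L[ℂ] antisym H (m + k)} {S : antisym H m →L[ℂ] antisym H m}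
    (h : IsPartialTrace m k T S) : partialTrace m k T = S := by
  have hex : ∃ S, IsPartialTrace m k T S := ⟨S, h⟩
  rw [partialTrace, dif_pos hex]
  exact hex.choose_spec.unique h

/-! ### The antisymmetrizer -/

theorem sgn_one {n : ℕ} : sgn (1 : Equiv.Perm (Fin n)) = 1 := by simp [sgn]

theorem sgn_mul {n : ℕ} (σ π : Equiv.Perm (Fin n)) : sgn (σ * π) = sgn σ * sgn π := by
  simp [sgn]

theorem sgn_inv {n : ℕ} (π : Equiv.Perm (Fin n)) : sgn π⁻¹ = sgn π := by simp [sgn]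

theorem sgn_mul_self {n : ℕ} (π : Equiv.Perm (Fin n)) : sgn π * sgn π = 1 := by
  rw [sgn, ← Int.cast_mul, ← Units.val_mul, Int.units_mul_self]
  simp

theorem conj_sgn {n : ℕ} (π : Equiv.Perm (Fin n)) : starRingEnd ℂ (sgn π) = sgn π := by
  simp [sgn]

theorem antisymmetrizer_apply {n : ℕ} (ψ : HilbertPow H n) :
    antisymmetrizer H n ψ = ((n.factorial : ℂ)⁻¹) • ∑ π, sgn π • permOp π ψ := by
  simp [antisymmetrizer]

theorem factorial_smul_antisymmetrizer_tprod {n : ℕ} (x : Fin n → H) :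
    (n.factorial : ℂ) • antisymmetrizer H n (HilbertPow.tprod x)
      = ∑ π, sgn π • HilbertPow.tprod (x ∘ π) := by
  rw [antisymmetrizer_apply, smul_smul, mul_inv_cancel₀ (by exact_mod_cast n.factorial_ne_zero),
    one_smul, ← Equiv.sum_comp (Equiv.inv (Equiv.Perm (Fin n)))]
  refine Finset.sum_congr rfl fun π _ => ?_
  rw [Equiv.inv_apply, sgn_inv, permOp_tprod]
  rfl

theorem antisymmetrizer_permOp {n : ℕ} (σ : Equiv.Perm (Fin n)) (ψ : HilbertPow H n) :
    antisymmetrizer H n (permOp σ ψ) = sgn σ • antisymmetrizer H n ψ := by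
  rw [antisymmetrizer_apply, antisymmetrizer_apply, smul_comm (sgn σ), Finset.smul_sum (r := sgn σ),
    ← Equiv.sum_comp (Equiv.mulRight σ) fun π => sgn σ • sgn π • permOp π ψ]
  refine congrArg _ (Finset.sum_congr rfl fun π _ => ?_)
  rw [Equiv.coe_mulRight, permOp_mul, ContinuousLinearMap.comp_apply, smul_smul, sgn_mul,
    mul_left_comm, sgn_mul_self, mul_one]

theorem antisymmetrizer_of_mem {n : ℕ} {ψ : HilbertPow H n} (h : ψ ∈ antisym H n) :
    antisymmetrizer H n ψ = ψ := by
  have e : ∀ π : Equiv.Perm (Fin n), sgn π • permOp π ψ = ψ := fun π => by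
    rw [h π, smul_smul, sgn_mul_self, one_smul]
  rw [antisymmetrizer_apply, Finset.sum_congr rfl fun π _ => e π]
  rw [Finset.sum_const, Finset.card_univ, Fintype.card_perm, Fintype.card_fin,
    ← Nat.cast_smul_eq_nsmul ℂ, smul_smul, inv_mul_cancel₀ (by exact_mod_cast n.factorial_ne_zero),
    one_smul]

theorem inner_permOp {n : ℕ} (π : Equiv.Perm (Fin n)) (ψ χ : HilbertPow H n) :
    inner ℂ (permOp π ψ) (permOp π χ) = inner ℂ ψ χ := by
  induction ψ using HilbertPow.induction with
  | hc => exact isClosed_eq (by fun_prop) (by fun_prop)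
  | h a =>
  induction χ using HilbertPow.induction with
  | hc => exact isClosed_eq (by fun_prop) (by fun_prop)
  | h b =>
  have e : ∀ c : AlgPow H n, permOp π (HilbertPow.ofAlg n c) = HilbertPow.ofAlg n (algPerm π c) :=
    fun c => by rw [permOp, HilbertPow.lift_coe]; rfl
  rw [e, e, LinearIsometry.inner_map_map, LinearIsometry.inner_map_map, inner_algPerm]

theorem inner_permOp_left {n : ℕ} (π : Equiv.Perm (Fin n)) (ψ χ : HilbertPow H n) :
    inner ℂ (permOp π ψ) χ = inner ℂ ψ (permOp π⁻¹ χ) := by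
  rw [← inner_permOp π ψ, ← ContinuousLinearMap.comp_apply, ← permOp_mul, mul_inv_cancel]
  have : (permOp 1 : HilbertPow H n →L[ℂ] HilbertPow H n) = .id ℂ _ :=
    HilbertPow.hom_ext fun x => by rw [permOp_tprod]; rfl
  rw [this]
  rfl

theorem inner_antisymmetrizer_left {n : ℕ} (ψ χ : HilbertPow H n) :
    inner ℂ (antisymmetrizer H n ψ) χ = inner ℂ ψ (antisymmetrizer H n χ) := by
  rw [antisymmetrizer_apply, antisymmetrizer_apply, inner_smul_left, inner_smul_right, sum_inner,
    inner_sum, map_inv₀, Complex.conj_natCast,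
    ← Equiv.sum_comp (Equiv.inv (Equiv.Perm (Fin n))) fun π => inner ℂ ψ (sgn π • permOp π χ)]
  refine congrArg _ (Finset.sum_congr rfl fun π _ => ?_)
  rw [inner_smul_left, inner_smul_right, conj_sgn, inner_permOp_left, Equiv.inv_apply, sgn_inv]

/-- The antisymmetrizer as a map onto the antisymmetric subspace. -/
def toAntisym {n : ℕ} (ψ : HilbertPow H n) : antisym H n :=
  ⟨antisymmetrizer H n ψ, antisymmetrizer_mem ψ⟩

/-- The antisymmetrizer is self-adjoint, takes antisymmetric values and fixes antisymmetric vectors.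
-/
theorem orthogonalProjectionOnto_antisym {n : ℕ} (ψ : HilbertPow H n) :
    (antisym H n).orthogonalProjectionOnto ψ = toAntisym ψ := by
  refine Subtype.ext ?_
  refine Submodule.eq_starProjection_of_mem_of_inner_eq_zero (antisymmetrizer_mem ψ) fun χ hχ => ?_
  rw [inner_sub_left, sub_eq_zero]
  exact (congrArg (inner ℂ ψ) (antisymmetrizer_of_mem hχ)).symm.trans
    (inner_antisymmetrizer_left ψ χ).symm

theorem inner_toAntisym_left {n : ℕ} (ψ : HilbertPow H n) (χ : antisym H n) :
    inner ℂ (toAntisym ψ) χ = inner ℂ ψ (χ : HilbertPow H n) := by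
  rw [Submodule.coe_inner, toAntisym, inner_antisymmetrizer_left, antisymmetrizer_of_mem χ.2]

theorem extendByZero_apply {n : ℕ} (B : antisym H n →L[ℂ] antisym H n) (ψ : HilbertPow H n) :
    extendByZero B ψ = B (toAntisym ψ) := by
  rw [← orthogonalProjectionOnto_antisym]
  rfl

theorem inner_extendByZero {n : ℕ} (B : antisym H n →L[ℂ] antisym H n) (ψ χ : HilbertPow H n) :
    inner ℂ ψ (extendByZero B χ) = inner ℂ (toAntisym ψ) (B (toAntisym χ)) := by
  rw [inner_toAntisym_left, extendByZero_apply]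

theorem extendByZero_rankOne {n : ℕ} (u v : antisym H n) :
    extendByZero (InnerProductSpace.rankOne ℂ u v)
      = InnerProductSpace.rankOne ℂ (u : HilbertPow H n) (v : HilbertPow H n) := by
  ext ψ
  rw [extendByZero_apply, InnerProductSpace.rankOne_apply, InnerProductSpace.rankOne_apply,
    ← inner_conj_symm, inner_toAntisym_left, inner_conj_symm]
  rfl

/-- `extendByZero` as a bounded linear map. -/
def extendByZeroL (n : ℕ) :
    (antisym H n →L[ℂ] antisym H n) →L[ℂ] HilbertPow H n →L[ℂ] HilbertPow H n :=
  (ContinuousLinearMap.compL ℂ (HilbertPow H n) (antisym H n) (HilbertPow H n)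
    (antisym H n).subtypeL) ∘L (ContinuousLinearMap.compL ℂ (HilbertPow H n) (antisym H n)
      (antisym H n)).flip (antisym H n).orthogonalProjectionOnto

theorem extendByZeroL_apply {n : ℕ} (B : antisym H n →L[ℂ] antisym H n) :
    extendByZeroL n B = extendByZero B := rfl

/-! ### Slater determinants -/

theorem slater_eq {n : ℕ} (x : Fin n → H) :
    slater x = (Real.sqrt n.factorial : ℂ) • toAntisym (HilbertPow.tprod x) := rfl

theorem sqrt_factorial_mul_self (n : ℕ) :
    (Real.sqrt n.factorial : ℂ) * (Real.sqrt n.factorial : ℂ) = n.factorial := by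
  rw [← Complex.ofReal_mul, Real.mul_self_sqrt (Nat.cast_nonneg _), Complex.ofReal_natCast]

theorem sqrt_factorial_ne_zero (n : ℕ) : (Real.sqrt n.factorial : ℂ) ≠ 0 := fun h => by
  have := sqrt_factorial_mul_self n
  rw [h, zero_mul] at this
  exact n.factorial_ne_zero (by exact_mod_cast this.symm)

/-- Because of this, the order chosen for the elements of s affects Ψ(s) only by a sign, which
cancels in |Ψ(s)⟩⟨Ψ(s)|. -/
theorem slater_comp_perm {n : ℕ} (x : Fin n → H) (π : Equiv.Perm (Fin n)) :
    slater (x ∘ π) = sgn π • slater x := by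
  have h : HilbertPow.tprod (x ∘ π) = permOp π⁻¹ (HilbertPow.tprod x) := by
    rw [permOp_tprod]; rfl
  rw [slater_eq, slater_eq, smul_comm]
  refine congrArg _ (Subtype.ext ?_)
  change antisymmetrizer H n _ = sgn π • antisymmetrizer H n _
  rw [h, antisymmetrizer_permOp, sgn_inv]

theorem coe_slater {n : ℕ} (x : Fin n → H) :
    (slater x : HilbertPow H n)
      = (Real.sqrt n.factorial : ℂ)⁻¹ • ∑ π, sgn π • HilbertPow.tprod (x ∘ π) := by
  rw [← factorial_smul_antisymmetrizer_tprod, smul_smul, ← sqrt_factorial_mul_self, ← mul_assoc,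
    inv_mul_cancel₀ (sqrt_factorial_ne_zero n), one_mul]
  rfl

theorem norm_slater {n : ℕ} {x : Fin n → H} (hx : Orthonormal ℂ x) : ‖slater x‖ = 1 := by
  have h : inner ℂ (slater x) (slater x) = (1 : ℂ) := by
    nth_rw 1 [slater_eq]
    rw [inner_smul_left, inner_toAntisym_left, coe_slater, inner_smul_right, Complex.conj_ofReal,
      -- Only the identity contributes: any other permutation moves some i and produces the
      -- vanishing factor ⟪x i, x (π i)⟫.
      ← mul_assoc, mul_inv_cancel₀ (sqrt_factorial_ne_zero n), one_mul, inner_sum,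
      Finset.sum_eq_single 1]
    · rw [sgn_one, one_smul, HilbertPow.inner_tprod]
      exact Finset.prod_eq_one fun i _ => by
        rw [Equiv.Perm.coe_one, Function.comp_id, inner_self_eq_norm_sq_to_K, hx.1]; simp
    · intro π _ hπ
      obtain ⟨i, hi⟩ : ∃ i, π i ≠ i := by
        by_contra! hc
        exact hπ (Equiv.ext hc)
      rw [inner_smul_right, HilbertPow.inner_tprod,
        Finset.prod_eq_zero (Finset.mem_univ i) (hx.2 hi.symm), mul_zero]
    · simp
  rw [inner_self_eq_norm_sq_to_K] at h
  have h' : ‖slater x‖ ^ 2 = 1 := by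
    have : ((‖slater x‖ ^ 2 : ℝ) : ℂ) = ((1 : ℝ) : ℂ) := by
      rw [Complex.ofReal_pow, Complex.ofReal_one]; exact h
    exact Complex.ofReal_injective this
  nlinarith [norm_nonneg (slater x)]

/-- Swapping two equal entries changes the sign of the vector and also leaves it unchanged. -/
theorem slater_eq_zero {n : ℕ} {x : Fin n → H} (hx : ¬ Function.Injective x) : slater x = 0 := by
  simp only [Function.Injective, not_forall] at hx
  obtain ⟨i, j, hij, hne⟩ := hx
  have h := slater_comp_perm x (Equiv.swap i j)
  have e : x ∘ Equiv.swap i j = x := by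
    funext l
    rcases eq_or_ne l i with rfl | hli
    · simp [hij]
    rcases eq_or_ne l j with rfl | hlj
    · simp [hij]
    simp [Equiv.swap_apply_of_ne_of_ne hli hlj]
  rw [e, sgn, Equiv.Perm.sign_swap hne] at h
  have h2 : (2 : ℂ) • slater x = 0 := by
    rw [two_smul]
    nth_rw 1 [h]
    simp
  exact (smul_eq_zero.1 h2).resolve_left two_ne_zero

/-! ### Reduction of a Slater determinant -/

/-- Permutations fixing the last k positions are exactly the permutations of the first m. In the
partial trace, orthonormality of the traced factors produces the vanishing hypothesis. -/
theorem sum_perm_eq_sum_of_fixing {m k : ℕ} {E : Type*} [AddCommMonoid E]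
    (F : Equiv.Perm (Fin (m + k)) → E)
    (hF : ∀ ρ, (∃ j : Fin k, ρ (Fin.natAdd m j) ≠ Fin.natAdd m j) → F ρ = 0) :
    ∑ ρ, F ρ = ∑ τ : Equiv.Perm (Fin m), F (finSumFinEquiv.permCongr (Equiv.Perm.sumCongr τ 1)) := by
  symm
  refine Finset.sum_of_injOn (fun τ => finSumFinEquiv.permCongr (Equiv.Perm.sumCongr τ 1))
    ?_ (fun _ _ => Finset.mem_coe.2 (Finset.mem_univ _)) ?_ (fun _ _ => rfl)
  · intro τ _ τ' _ h
    have h' := finSumFinEquiv.permCongr.injective h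
    ext i
    have := congrArg (fun π : Equiv.Perm (Fin m ⊕ Fin k) => π (Sum.inl i)) h'
    rw [Equiv.Perm.sumCongr_apply, Equiv.Perm.sumCongr_apply] at this
    exact congrArg Fin.val (Sum.inl_injective this)
  · intro ρ _ hρ
    by_contra hne
    have hfix : ∀ j : Fin k, ρ (Fin.natAdd m j) = Fin.natAdd m j := by
      by_contra! hc
      exact hne (hF ρ hc)
    set ρ' : Equiv.Perm (Fin m ⊕ Fin k) := finSumFinEquiv.symm.permCongr ρ with hρ'
    have hr : ∀ j, ρ' (Sum.inr j) = Sum.inr j := fun j => by simp [hρ', hfix]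
    have hmaps : Set.MapsTo ρ' (Set.range Sum.inl) (Set.range Sum.inl) := by
      rintro _ ⟨i, rfl⟩
      rcases h : ρ' (Sum.inl i) with a | b
      · exact ⟨a, rfl⟩
      · rw [← hr b] at h
        exact absurd (ρ'.injective h) (by simp)
    obtain ⟨⟨τ, σ⟩, hτ⟩ := Equiv.Perm.mem_sumCongrHom_range_of_perm_mapsTo_inl hmaps
    have hσ : σ = 1 := by
      ext j
      have := congrArg (fun π : Equiv.Perm (Fin m ⊕ Fin k) => π (Sum.inr j)) hτ
      simp only [hr] at this
      rw [Equiv.Perm.sumCongrHom_apply, Equiv.Perm.sumCongr_apply] at this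
      exact congrArg Fin.val (Sum.inr_injective this)
    refine hρ ⟨τ, Finset.mem_coe.2 (Finset.mem_univ _), ?_⟩
    have : Equiv.Perm.sumCongr τ 1 = ρ' := by rw [← hσ]; exact hτ
    simp only [this, hρ']
    ext; simp

theorem sgn_permCongr_sumCongr {m k : ℕ} (τ : Equiv.Perm (Fin m)) :
    sgn (finSumFinEquiv.permCongr (Equiv.Perm.sumCongr τ (1 : Equiv.Perm (Fin k)))) = sgn τ := by
  rw [sgn, Equiv.Perm.sign_permCongr, Equiv.Perm.sign_sumCongr, Equiv.Perm.sign_one, mul_one, sgn]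

/-- The first `m` entries of an `(m + k)`-tuple. -/
def initial {α : Type*} (m k : ℕ) (x : Fin (m + k) → α) : Fin m → α := fun i => x (Fin.castAdd k i)

theorem inner_ampliate_tprod {m k : ℕ} (B : HilbertPow H m →L[ℂ] HilbertPow H m)
    (x y : Fin (m + k) → H) :
    inner ℂ (HilbertPow.tprod x) (ampliate B k (HilbertPow.tprod y))
      = inner ℂ (HilbertPow.tprod (initial m k x)) (B (HilbertPow.tprod (initial m k y)))
        * ∏ j, inner ℂ (x (Fin.natAdd m j)) (y (Fin.natAdd m j)) := by
  have e : ∀ z : Fin (m + k) → H, HilbertPow.tprod z = HilbertPow.mul m k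
      (HilbertPow.tprod (initial m k z)) (HilbertPow.tprod fun j => z (Fin.natAdd m j)) := fun z => by
    rw [HilbertPow.mul_tprod]; exact congrArg _ (Fin.append_castAdd_natAdd).symm
  rw [e x, e y, ampliate_mul, HilbertPow.inner_mul, HilbertPow.inner_tprod]

/-- The extension of `B` by 0 antisymmetrizes on both sides, so one of the two antisymmetrizers can
be dropped and the other expanded; the two roots of m! combine to cancel its 1/m!. -/
theorem inner_slater_slater {m : ℕ} (B : antisym H m →L[ℂ] antisym H m) (y : Fin m → H) :
    inner ℂ (slater y) (B (slater y))
      = ∑ τ : Equiv.Perm (Fin m), sgn τ * inner ℂ (HilbertPow.tprod y)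
          (extendByZero B (HilbertPow.tprod (y ∘ τ))) := by
  rw [slater_eq, map_smul, inner_smul_left, inner_smul_right, ← mul_assoc, Complex.conj_ofReal,
    sqrt_factorial_mul_self, ← inner_extendByZero, ← inner_smul_right]
  have h : extendByZero B (HilbertPow.tprod y)
      = extendByZero B (antisymmetrizer H m (HilbertPow.tprod y)) := by
    rw [extendByZero_apply, extendByZero_apply]
    congr 2
    exact Subtype.ext (antisymmetrizer_of_mem (antisymmetrizer_mem _)).symm
  rw [h, ← map_smul, factorial_smul_antisymmetrizer_tprod, map_sum, inner_sum]
  simp only [map_smul, inner_smul_right]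

/-- Expand both Slater vectors, with permutations π and πρ. The last k factors force ρ to fix the
last k positions, so ρ comes from a permutation τ of the first m; the signs combine to sgn τ, and
the sum over τ reassembles an m-particle Slater matrix element. -/
theorem inner_slater_ampliate {m k : ℕ} (B : antisym H m →L[ℂ] antisym H m)
    {x : Fin (m + k) → H} (hx : Orthonormal ℂ x) :
    inner ℂ (slater x : HilbertPow H (m + k))
        (ampliate (extendByZero B) k (slater x : HilbertPow H (m + k)))
      = ((m + k).factorial : ℂ)⁻¹ * ∑ π : Equiv.Perm (Fin (m + k)),
          inner ℂ (slater (initial m k (x ∘ π))) (B (slater (initial m k (x ∘ π)))) := by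
  rw [coe_slater, map_smul, inner_smul_left, inner_smul_right, ← mul_assoc, map_inv₀,
    Complex.conj_ofReal, ← mul_inv, sqrt_factorial_mul_self, sum_inner]
  refine congrArg _ (Finset.sum_congr rfl fun π _ => ?_)
  rw [map_sum, inner_sum, ← Equiv.sum_comp (Equiv.mulLeft π), sum_perm_eq_sum_of_fixing,
    inner_slater_slater]
  · refine Finset.sum_congr rfl fun τ _ => ?_
    rw [Equiv.coe_mulLeft, map_smul, inner_smul_left, inner_smul_right, inner_ampliate_tprod,
      conj_sgn, sgn_mul, ← mul_assoc, ← mul_assoc, ← mul_assoc, sgn_mul_self, one_mul,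
      sgn_permCongr_sumCongr, Finset.prod_eq_one, mul_one]
    · congr 3
      refine congrArg HilbertPow.tprod (funext fun i => ?_)
      simp [initial]
    · intro j _
      simp [inner_self_eq_norm_sq_to_K, hx.1]
  · rintro ρ ⟨j, hj⟩
    rw [Equiv.coe_mulLeft, map_smul, inner_smul_left, inner_smul_right, inner_ampliate_tprod,
      Finset.prod_eq_zero (Finset.mem_univ j), mul_zero, mul_zero, mul_zero]
    refine hx.2 fun h => hj ?_
    exact (π.injective h).symm

/-! ### Independent occupation numbers -/

section Occupations

variable {J : Type*}

theorem summable_toReal_pmf {α : Type*} (P : PMF α) : Summable fun s => (P s).toReal :=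
  ENNReal.summable_toReal P.tsum_coe_ne_top

theorem tsum_toReal_pmf {α : Type*} (P : PMF α) : ∑' s, (P s).toReal = 1 := by
  rw [← ENNReal.tsum_toReal_eq fun s => P.apply_ne_top s, P.tsum_coe, ENNReal.toReal_one]

/-- The probability that `j` is occupied. -/
def occProb (P : PMF (Finset J)) (j : J) : ℝ :=
  (@PMF.toMeasure _ ⊤ P {s | j ∈ s}).toReal

theorem occProb_nonneg (P : PMF (Finset J)) (j : J) : 0 ≤ occProb P j := ENNReal.toReal_nonneg

theorem IndependentOccupations.measure_subset {P : PMF (Finset J)} (hP : IndependentOccupations P)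
    (t : Finset J) : (@PMF.toMeasure _ ⊤ P {s | t ⊆ s}).toReal = ∏ j ∈ t, occProb P j := by
  let _ : MeasurableSpace (Finset J) := ⊤
  -- Each event is the preimage of {1} under an occupation number, so it lies in the σ-algebra which
  -- that number generates.
  have h := hP.meas_biInter (S := t) (s := fun j => {s | j ∈ s}) fun j _ =>
    ⟨{1}, trivial, by ext s; simp [occupation]⟩
  have e : (⋂ j ∈ t, {s : Finset J | j ∈ s}) = {s | t ⊆ s} := by
    ext s; simp [Finset.subset_iff]
  rw [e] at h
  rw [h, ENNReal.toReal_prod]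
  rfl

theorem IndependentOccupations.measure_disjoint {P : PMF (Finset J)}
    (hP : IndependentOccupations P) (t : Finset J) :
    (@PMF.toMeasure _ ⊤ P {s | Disjoint t s}).toReal = ∏ j ∈ t, (1 - occProb P j) := by
  let _ : MeasurableSpace (Finset J) := ⊤
  have h := hP.meas_biInter (S := t) (s := fun j => {s | j ∈ s}ᶜ) fun j _ =>
    ⟨{0}, trivial, by ext s; simp [occupation]⟩
  have e : (⋂ j ∈ t, {s : Finset J | j ∈ s}ᶜ) = {s | Disjoint t s} := by
    ext s; simp [Finset.disjoint_left]
  rw [e] at h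
  rw [h, ENNReal.toReal_prod]
  refine Finset.prod_congr rfl fun j _ => ?_
  exact MeasureTheory.probReal_compl_eq_one_sub (μ := P.toMeasure) (s := {s | j ∈ s}) trivial

theorem toReal_le_measure (P : PMF (Finset J)) {s : Finset J} {A : Set (Finset J)} (hs : s ∈ A) :
    (P s).toReal ≤ (@PMF.toMeasure _ ⊤ P A).toReal := by
  let _ : MeasurableSpace (Finset J) := ⊤
  refine ENNReal.toReal_mono (MeasureTheory.measure_ne_top _ _) ?_
  rw [← P.toMeasure_apply_singleton s trivial]
  exact MeasureTheory.measure_mono (Set.singleton_subset_iff.2 hs)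

/-- Some finite s₀ has positive probability. For finite F it belongs to the event that F \ s₀ is
unoccupied, whose probability ∏ (1 - p_j) is at most exp(-∑ p_j). Taking logarithms bounds the sum
over F \ s₀ uniformly in F. -/
theorem IndependentOccupations.summable_occProb {P : PMF (Finset J)}
    (hP : IndependentOccupations P) : Summable (occProb P) := by
  classical
  obtain ⟨s₀, hs₀⟩ := P.support_nonempty
  have hpos : 0 < (P s₀).toReal :=
    ENNReal.toReal_pos ((P.mem_support_iff s₀).1 hs₀) (P.apply_ne_top s₀)
  refine summable_of_sum_le (c := ∑ j ∈ s₀, occProb P j - Real.log (P s₀).toReal)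
    (occProb_nonneg P) fun F => ?_
  have h1 : (P s₀).toReal ≤ Real.exp (-∑ j ∈ F \ s₀, occProb P j) := by
    refine (toReal_le_measure P (A := {s | Disjoint (F \ s₀) s}) Finset.sdiff_disjoint).trans ?_
    rw [hP.measure_disjoint, ← Finset.sum_neg_distrib, Real.exp_sum]
    refine Finset.prod_le_prod (fun j _ => sub_nonneg.2 ?_) fun j _ =>
      Real.one_sub_le_exp_neg _
    let _ : MeasurableSpace (Finset J) := ⊤
    exact MeasureTheory.measureReal_le_one (μ := P.toMeasure) (s := {s | j ∈ s})
  have h2 := (Real.log_le_iff_le_exp hpos).2 h1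
  have h3 : ∑ j ∈ F, occProb P j ≤ ∑ j ∈ F \ s₀, occProb P j + ∑ j ∈ s₀, occProb P j := by
    rw [← Finset.sum_inter_add_sum_sdiff F s₀, add_comm]
    refine add_le_add_right (Finset.sum_le_sum_of_subset_of_nonneg Finset.inter_subset_right
      fun j _ _ => occProb_nonneg P j) _
  linarith

open scoped Classical in
/-- The weight `P(s)` of a pair of finite sets `t ⊆ s`, and `0` for other pairs. -/
def pairWeight (P : PMF (Finset J)) (q : Finset J × Finset J) : ℝ :=
  if q.2 ⊆ q.1 then (P q.1).toReal else 0

theorem pairWeight_nonneg (P : PMF (Finset J)) (q : Finset J × Finset J) : 0 ≤ pairWeight P q := by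
  unfold pairWeight
  split_ifs
  exacts [ENNReal.toReal_nonneg, le_rfl]

/-- For fixed t the weights add up to Prob(t ⊆ s), which factors by independence. -/
theorem IndependentOccupations.hasSum_pairWeight_left {P : PMF (Finset J)}
    (hP : IndependentOccupations P) (t : Finset J) :
    HasSum (fun s => pairWeight P (s, t)) (∏ j ∈ t, occProb P j) := by
  classical
  let _ : MeasurableSpace (Finset J) := ⊤
  have e : ∀ s, pairWeight P (s, t) = (Set.indicator {s | t ⊆ s} P s).toReal := fun s => by
    by_cases h : t ⊆ s <;> simp [pairWeight, Set.indicator, h]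
  have hm : MeasurableSet {s : Finset J | t ⊆ s} := trivial
  have hne : ∑' s, Set.indicator {s | t ⊆ s} P s ≠ ⊤ := by
    rw [← P.toMeasure_apply (hs := hm)]
    exact MeasureTheory.measure_ne_top _ _
  have h := ENNReal.hasSum_toReal hne
  rw [← ENNReal.tsum_toReal_eq fun s => ne_top_of_le_ne_top (P.apply_ne_top s)
    (Set.indicator_le_self _ _ _), ← P.toMeasure_apply (hs := hm), hP.measure_subset] at h
  simpa only [e] using h

theorem hasSum_pairWeight_right (P : PMF (Finset J)) (s : Finset J) :
    HasSum (fun t => pairWeight P (s, t)) ((P s).toReal * 2 ^ s.card) := by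
  classical
  have h : HasSum (fun t => pairWeight P (s, t)) (∑ t ∈ s.powerset, pairWeight P (s, t)) :=
    hasSum_sum_of_ne_finset_zero fun t ht => by
      rw [pairWeight, if_neg (by simpa using ht)]
  have e : ∀ t ∈ s.powerset, pairWeight P (s, t) = (P s).toReal := fun t ht => by
    rw [pairWeight, if_pos (by simpa using ht)]
  rw [Finset.sum_congr rfl e, Finset.sum_const, Finset.card_powerset, nsmul_eq_mul, mul_comm] at h
  exact_mod_cast h

theorem IndependentOccupations.summable_pairWeight {P : PMF (Finset J)}
    (hP : IndependentOccupations P) : Summable (pairWeight P) := by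
  rw [← (Equiv.prodComm _ _).summable_iff]
  refine (summable_prod_of_nonneg fun q => pairWeight_nonneg P _).2
    ⟨fun t => (hP.hasSum_pairWeight_left t).summable, ?_⟩
  -- Summability of the p_j makes the expansion ∑_t ∏_{j ∈ t} p_j of ∏ (1 + p_j) converge.
  refine (summable_finsetProd_of_summable_nonneg (occProb_nonneg P) hP.summable_occProb).congr
    fun t => ?_
  exact (hP.hasSum_pairWeight_left t).tsum_eq.symm

/-- The same weights summed over t first: a set s has 2^|s| subsets. This exponential moment
dominates every power of |s|. -/
theorem IndependentOccupations.summable_two_pow_card {P : PMF (Finset J)}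
    (hP : IndependentOccupations P) : Summable fun s => (P s).toReal * 2 ^ s.card :=
  ((summable_prod_of_nonneg (pairWeight_nonneg P)).1 hP.summable_pairWeight).2.congr fun s =>
    (hasSum_pairWeight_right P s).tsum_eq

theorem IndependentOccupations.summable_card_pow {P : PMF (Finset J)}
    (hP : IndependentOccupations P) (m : ℕ) :
    Summable fun s => (P s).toReal * (s.card : ℝ) ^ m := by
  obtain ⟨C, hC⟩ : ∃ C : ℝ, ∀ n : ℕ, (n : ℝ) ^ m ≤ C * 2 ^ n := by
    have h := (tendsto_pow_const_div_const_pow_of_one_lt m (one_lt_two (α := ℝ))).bddAbove_range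
    obtain ⟨C, hC⟩ := h
    exact ⟨C, fun n => (div_le_iff₀ (by positivity)).1 (hC ⟨n, rfl⟩)⟩
  refine (hP.summable_two_pow_card.mul_left C).of_nonneg_of_le (fun s => by positivity) fun s => ?_
  calc (P s).toReal * (s.card : ℝ) ^ m ≤ (P s).toReal * (C * 2 ^ s.card) :=
        mul_le_mul_of_nonneg_left (hC _) ENNReal.toReal_nonneg
    _ = _ := by ring

end Occupations

/-! ### Slater determinants indexed by finite sets -/

theorem card_perm_image_initial {m k : ℕ} {t : Finset (Fin (m + k))} (ht : t.card = m) :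
    (Finset.univ.filter fun π : Equiv.Perm (Fin (m + k)) =>
      Finset.univ.image (initial m k π) = t).card = m.factorial * k.factorial := by
  have h := Numbering.card_prefixed t
  rw [Fintype.card_fin, ht, Nat.add_sub_cancel_left] at h
  rw [← h]
  -- A numbering sends elements to positions while π sends positions to elements, hence the inverse.
  refine Finset.card_equiv ((Equiv.inv _).trans
    (Equiv.equivCongr (Equiv.refl _) (finCongr (Fintype.card_fin (m + k)).symm))) fun π => ?_
  have himg : ∀ x, x ∈ Finset.univ.image (initial m k π) ↔ (π⁻¹ x : ℕ) < m := by
    intro x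
    simp only [Finset.mem_image, Finset.mem_univ, true_and, initial]
    constructor
    · rintro ⟨i, rfl⟩
      simp
    · intro hx
      exact ⟨⟨π⁻¹ x, hx⟩, by simp [Fin.castAdd, Fin.castLE]⟩
  simp only [Finset.mem_filter, Finset.mem_univ, true_and, Numbering.mem_prefixed,
    Numbering.IsPrefix, Finset.ext_iff, himg, ht]
  exact forall_congr' fun x => Iff.comm

theorem sum_perm_image_initial {m k : ℕ} (F : Finset (Fin (m + k)) → ℂ) :
    ∑ π : Equiv.Perm (Fin (m + k)), F (Finset.univ.image (initial m k π))
      = (m.factorial * k.factorial : ℂ) * ∑ t ∈ Finset.univ.powersetCard m, F t := by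
  have hmaps : ∀ π ∈ (Finset.univ : Finset (Equiv.Perm (Fin (m + k)))),
      Finset.univ.image (initial m k π) ∈ Finset.univ.powersetCard m := fun π _ => by
    have hinj : Function.Injective (initial m k π) :=
      π.injective.comp (Fin.castAdd_injective m k)
    rw [Finset.mem_powersetCard, Finset.card_image_of_injective _ hinj]
    simp
  rw [← Finset.sum_fiberwise_of_maps_to hmaps, Finset.mul_sum]
  refine Finset.sum_congr rfl fun t ht => ?_
  rw [Finset.sum_congr rfl fun π hπ => congrArg F (Finset.mem_filter.1 hπ).2, Finset.sum_const,
    card_perm_image_initial (Finset.mem_powersetCard.1 ht).2, nsmul_eq_mul, Nat.cast_mul]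

section SlaterVec

variable {J : Type*}

/-- The `n`-particle component of `Ψ(s)`: it vanishes unless `s` has `n` elements. -/
def slaterVec (φ : J → H) (e : ∀ s : Finset J, Fin s.card ≃ s) (n : ℕ) (s : Finset J) :
    antisym H n := slaterFock φ e s n

variable {φ : J → H} {e : ∀ s : Finset J, Fin s.card ≃ s} {n m k : ℕ}

theorem slaterVec_of_card_ne {s : Finset J} (h : s.card ≠ n) : slaterVec φ e n s = 0 := by
  rw [slaterVec, slaterFock, lp.coeFn_single, Pi.single_eq_of_ne h.symm]

theorem slaterVec_card (s : Finset J) :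
    slaterVec φ e s.card s = slater (φ ∘ fun i => (e s i : J)) := by
  rw [slaterVec, slaterFock, lp.coeFn_single, Pi.single_eq_same]
  rfl

/-- Replaces the enumeration `e s`, whose domain depends on s, by an injection from a fixed `Fin n`.
-/
theorem exists_slaterVec_eq [DecidableEq J] {s : Finset J} (h : s.card = n) :
    ∃ f : Fin n → J, Function.Injective f ∧ Finset.univ.image f = s ∧
      slaterVec φ e n s = slater (φ ∘ f) := by
  subst h
  refine ⟨fun i => e s i, Subtype.val_injective.comp (e s).injective, ?_, slaterVec_card s⟩
  ext j
  simp only [Finset.mem_image, Finset.mem_univ, true_and]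
  exact ⟨by rintro ⟨i, rfl⟩; exact (e s i).2, fun hj => ⟨(e s).symm ⟨j, hj⟩, by simp⟩⟩

theorem exists_perm_of_image_eq [DecidableEq J] {f g : Fin n → J} (hf : Function.Injective f)
    (h : Finset.univ.image f = Finset.univ.image g) : ∃ π : Equiv.Perm (Fin n), f = g ∘ π := by
  have hex : ∀ i, ∃ j, g j = f i := fun i => by
    have : f i ∈ Finset.univ.image g := h ▸ Finset.mem_image_of_mem f (Finset.mem_univ i)
    simpa using this
  choose p hp using hex
  have hinj : Function.Injective p := fun i j hij => hf (by rw [← hp, ← hp, hij])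
  exact ⟨Equiv.ofBijective p (Finite.injective_iff_bijective.1 hinj), funext fun i => (hp i).symm⟩

theorem exists_slater_eq [DecidableEq J] (φ : J → H) (e : ∀ s : Finset J, Fin s.card ≃ s)
    {f : Fin n → J} (hf : Function.Injective f) :
    ∃ π : Equiv.Perm (Fin n), slater (φ ∘ f) = sgn π • slaterVec φ e n (Finset.univ.image f) := by
  obtain ⟨g, -, hgi, hg⟩ := exists_slaterVec_eq (φ := φ) (e := e) (s := Finset.univ.image f)
    (by rw [Finset.card_image_of_injective _ hf, Finset.card_univ, Fintype.card_fin])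
  obtain ⟨π, rfl⟩ := exists_perm_of_image_eq hf hgi.symm
  exact ⟨π, by rw [hg, ← slater_comp_perm, Function.comp_assoc]⟩

theorem inner_slater_eq_inner_slaterVec [DecidableEq J] (φ : J → H)
    (e : ∀ s : Finset J, Fin s.card ≃ s) {f : Fin n → J} (hf : Function.Injective f)
    (B : antisym H n →L[ℂ] antisym H n) :
    inner ℂ (slater (φ ∘ f)) (B (slater (φ ∘ f))) = inner ℂ (slaterVec φ e n (Finset.univ.image f))
      (B (slaterVec φ e n (Finset.univ.image f))) := by
  obtain ⟨π, h⟩ := exists_slater_eq φ e hf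
  rw [h, map_smul, inner_smul_left, inner_smul_right, conj_sgn, ← mul_assoc, sgn_mul_self, one_mul]

theorem norm_slaterVec (hφ : Orthonormal ℂ φ) {s : Finset J} (h : s.card = n) :
    ‖slaterVec φ e n s‖ = 1 := by
  classical
  obtain ⟨f, hf, -, hs⟩ := exists_slaterVec_eq (φ := φ) (e := e) h
  rw [hs, norm_slater (hφ.comp f hf)]

theorem norm_slaterVec_le (hφ : Orthonormal ℂ φ) (s : Finset J) : ‖slaterVec φ e n s‖ ≤ 1 := by
  by_cases h : s.card = n
  · exact (norm_slaterVec hφ h).le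
  · rw [slaterVec_of_card_ne h, norm_zero]
    exact zero_le_one

/-- If no factor ⟪φ (f i), φ (g (π i))⟫ vanished, then f = g ∘ π and the images would agree. -/
theorem inner_slater_eq_zero [DecidableEq J] (hφ : Orthonormal ℂ φ) {f g : Fin n → J}
    (h : Finset.univ.image f ≠ Finset.univ.image g) :
    inner ℂ (slater (φ ∘ f)) (slater (φ ∘ g)) = (0 : ℂ) := by
  rw [slater_eq, inner_smul_left, inner_toAntisym_left, coe_slater, inner_smul_right, inner_sum,
    Finset.sum_eq_zero, mul_zero, mul_zero]
  intro π _
  obtain ⟨i, hi⟩ : ∃ i, f i ≠ g (π i) := by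
    by_contra! hc
    refine h ?_
    rw [show f = g ∘ π from funext hc, ← Finset.image_image, Finset.image_univ_equiv]
  rw [inner_smul_right, HilbertPow.inner_tprod, Finset.prod_eq_zero (Finset.mem_univ i) (hφ.2 hi),
    mul_zero]

theorem inner_slaterVec_eq_zero (hφ : Orthonormal ℂ φ) {s t : Finset J} (h : s ≠ t) :
    inner ℂ (slaterVec φ e n s) (slaterVec φ e n t) = (0 : ℂ) := by
  classical
  by_cases hs : s.card = n
  swap; · rw [slaterVec_of_card_ne hs, inner_zero_left]
  by_cases ht : t.card = n
  swap; · rw [slaterVec_of_card_ne ht, inner_zero_right]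
  obtain ⟨f, -, rfl, hs'⟩ := exists_slaterVec_eq (φ := φ) (e := e) hs
  obtain ⟨g, -, rfl, ht'⟩ := exists_slaterVec_eq (φ := φ) (e := e) ht
  rw [hs', ht', inner_slater_eq_zero hφ h]

/-- The reduction of a Slater determinant to `m` particles is the uniform mixture of the Slater
determinants of the subsets with `m` elements. -/
theorem inner_slaterVec_ampliate (hφ : Orthonormal ℂ φ) (B : antisym H m →L[ℂ] antisym H m)
    {s : Finset J} (hs : s.card = m + k) :
    inner ℂ (slaterVec φ e (m + k) s : HilbertPow H (m + k))
        (ampliate (extendByZero B) k (slaterVec φ e (m + k) s : HilbertPow H (m + k)))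
      = ((m.factorial * k.factorial : ℝ) / (m + k).factorial : ℝ) * ∑ t ∈ s.powersetCard m,
          inner ℂ (slaterVec φ e m t) (B (slaterVec φ e m t)) := by
  classical
  obtain ⟨f, hf, hfs, hs'⟩ := exists_slaterVec_eq (φ := φ) (e := e) hs
  rw [hs', inner_slater_ampliate B (hφ.comp f hf)]
  let F : Finset (Fin (m + k)) → ℂ := fun t => inner ℂ (slaterVec φ e m (t.image f))
    (B (slaterVec φ e m (t.image f)))
  have e1 : ∀ π : Equiv.Perm (Fin (m + k)),
      inner ℂ (slater (initial m k ((φ ∘ f) ∘ π))) (B (slater (initial m k ((φ ∘ f) ∘ π))))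
        = F (Finset.univ.image (initial m k π)) := by
    intro π
    have := inner_slater_eq_inner_slaterVec φ e (f := f ∘ initial m k π)
      (hf.comp (π.injective.comp (Fin.castAdd_injective m k))) B
    rw [← Finset.image_image] at this
    exact this
  rw [Finset.sum_congr rfl fun π _ => e1 π, sum_perm_image_initial F, ← mul_assoc]
  have e2 : s.powersetCard m = (Finset.univ.powersetCard m).image fun t => t.image f := by
    have := Finset.powersetCard_map ⟨f, hf⟩ m Finset.univ
    rw [Finset.map_eq_image, Finset.map_eq_image] at this
    refine (congrArg _ hfs.symm).trans (this.trans (Finset.image_congr fun t _ => ?_))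
    simp [Finset.map_eq_image]
  rw [e2, Finset.sum_image fun t _ t' _ h => Finset.image_injective hf h]
  congr 1
  push_cast
  ring

end SlaterVec

/-! ### The components of a mixture of Slater determinants -/

section Mixture

open InnerProductSpace

variable {J : Type*} {φ : J → H} {e : ∀ s : Finset J, Fin s.card ≃ s} {P : PMF (Finset J)}

theorem slaterFock_eq_single (s : Finset J) :
    slaterFock φ e s = lp.single 2 s.card (slaterVec φ e s.card s) := by
  rw [slaterVec_card]
  rfl

theorem norm_slaterFock (hφ : Orthonormal ℂ φ) (s : Finset J) : ‖slaterFock φ e s‖ = 1 := by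
  rw [slaterFock_eq_single, lp.norm_single (by norm_num), norm_slaterVec hφ rfl]

theorem starProjection_slaterFock (hφ : Orthonormal ℂ φ) (s : Finset J) :
    (Submodule.span ℂ {slaterFock φ e s}).starProjection
      = rankOne ℂ (slaterFock φ e s) (slaterFock φ e s) := by
  ext1 ψ
  rw [Submodule.starProjection_unit_singleton ℂ (norm_slaterFock hφ s), rankOne_apply]

theorem isMixture_slaterMixture (hφ : Orthonormal ℂ φ) :
    IsMixture (fun s => (P s).toReal) (slaterFock φ e) (slaterMixture φ e P) := by
  simp only [slaterMixture, starProjection_slaterFock hφ]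
  exact isMixture_tsum (fun s => ENNReal.toReal_nonneg) (summable_toReal_pmf P)
    fun s => (norm_slaterFock hφ s).le

theorem isDensityOperator_slaterMixture (hφ : Orthonormal ℂ φ) :
    IsDensityOperator (slaterMixture φ e P) := by
  have h := isMixture_slaterMixture (e := e) (P := P) hφ
  refine ⟨h.isPositive, h.isTraceClass, ?_⟩
  rw [h.trace_eq]
  simp only [norm_slaterFock hφ, Complex.ofReal_one, one_pow, mul_one]
  rw [← Complex.ofReal_tsum, tsum_toReal_pmf, Complex.ofReal_one]

theorem inner_slaterFock (s : Finset J) (ψ : Fock H) :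
    inner ℂ (slaterFock φ e s) ψ = inner ℂ (slaterVec φ e s.card s) (ψ s.card) := by
  rw [slaterFock_eq_single, lp.inner_single_left]

theorem commutesWithNumber_slaterMixture (hφ : Orthonormal ℂ φ) :
    CommutesWithNumber (slaterMixture φ e P) := by
  intro ψ χ h n
  have hs : ∀ ψ : Fock H, HasSum (fun s => ((P s).toReal : ℂ) •
      inner ℂ (slaterFock φ e s) ψ • slaterVec φ e n s) (slaterMixture φ e P ψ n) := fun ψ =>
    ((isMixture_slaterMixture (e := e) (P := P) hφ).hasSum.mapL
      (ContinuousLinearMap.apply ℂ (Fock H) ψ)).mapL (lp.evalCLM ℂ (fun n : ℕ => antisym H n) 2 n)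
  refine (hs χ).unique ?_
  convert! (hs ψ).const_smul (n : ℂ) using 1
  funext s
  -- Each Ψ(s) has a single particle number, so only sets with n elements contribute to the
  -- component n.
  by_cases hn : s.card = n
  · subst hn
    rw [inner_slaterFock, inner_slaterFock, h, inner_smul_right, smul_smul, smul_smul, smul_smul,
      mul_left_comm, mul_assoc]
  · rw [slaterVec_of_card_ne hn]; simp

theorem component_rankOne (u v : Fock H) (n : ℕ) :
    component (rankOne ℂ u v) n = rankOne ℂ (u n) (v n) := by
  ext1 ψ
  change (inner ℂ v (lp.single 2 n ψ) • u : Fock H) n = _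
  rw [lp.inner_single_right]
  rfl

/-- `component` as a bounded linear map. -/
def componentL (n : ℕ) : (Fock H →L[ℂ] Fock H) →L[ℂ] antisym H n →L[ℂ] antisym H n :=
  (ContinuousLinearMap.compL ℂ (antisym H n) (Fock H) (antisym H n)
    (lp.evalCLM ℂ (fun n : ℕ => antisym H n) 2 n)) ∘L
    (ContinuousLinearMap.compL ℂ (antisym H n) (Fock H) (Fock H)).flip
      (lp.singleContinuousLinearMap ℂ (fun n : ℕ => antisym H n) 2 n)

theorem componentL_apply (D : Fock H →L[ℂ] Fock H) (n : ℕ) : componentL n D = component D n := rfl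

/-- The index set remains all finite sets: those of the wrong size contribute the zero vector, which
`IsMixture` allows since it asks only for norm at most 1. -/
theorem isMixture_component (hφ : Orthonormal ℂ φ) (n : ℕ) :
    IsMixture (fun s => (P s).toReal) (slaterVec φ e n) (component (slaterMixture φ e P) n) := by
  refine ⟨fun s => ENNReal.toReal_nonneg, summable_toReal_pmf P, norm_slaterVec_le hφ, ?_⟩
  have h := (isMixture_slaterMixture (e := e) (P := P) hφ).hasSum.mapL (componentL n)
  simp only [map_smul, componentL_apply, component_rankOne] at h
  exact h

theorem IsMixture.extendByZero {ι : Type*} {r : ι → ℝ} {n : ℕ} {u : ι → antisym H n}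
    {T : antisym H n →L[ℂ] antisym H n} (h : IsMixture r u T) :
    IsMixture r (fun s => (u s : HilbertPow H n)) (extendByZero T) := by
  refine ⟨h.nonneg, h.summable, h.norm_le, ?_⟩
  have := h.hasSum.mapL (extendByZeroL n)
  simpa only [map_smul, extendByZeroL_apply, extendByZero_rankOne] using this

/-- Sums may be computed by first summing over the fibres of a map. -/
theorem hasSum_of_hasSum_fiber {ι κ E : Type*} [DecidableEq κ] [AddCommMonoid E]
    [TopologicalSpace E] [ContinuousAdd E] [RegularSpace E] {f : ι → E} {a : E} (hf : HasSum f a)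
    (c : ι → κ) {g : κ → E} (hg : ∀ k, HasSum (fun i => if c i = k then f i else 0) (g k)) :
    HasSum g a := by
  -- The series is carried to the graph of `c` inside `κ × ι`, extended by 0, and then summed along
  -- the rows.
  have hinj : Function.Injective fun i => (c i, i) := fun i j h => (Prod.ext_iff.1 h).2
  have h : HasSum (fun q : κ × ι => if c q.2 = q.1 then f q.2 else 0) a := by
    rw [← hinj.hasSum_iff]
    · simpa [Function.comp_def] using hf
    · rintro ⟨k, i⟩ hq
      exact if_neg fun h => hq ⟨i, by simp at h; simp [h]⟩
  exact h.prod_fiberwise hg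

theorem finiteMoment_slaterMixture (hφ : Orthonormal ℂ φ) (hP : IndependentOccupations P) (m : ℕ) :
    FiniteMoment m (slaterMixture φ e P) := by
  classical
  -- The moment series is the series of P(s) |s|^m grouped by |s| = n, as the trace of the component
  -- n is the probability of that size.
  refine (hasSum_of_hasSum_fiber (hP.summable_card_pow m).hasSum Finset.card fun n => ?_).summable
  have h := isMixture_component (e := e) (P := P) hφ n
  have e1 : ∀ s, ((P s).toReal : ℂ) * (‖slaterVec φ e n s‖ : ℂ) ^ 2
      = ((if s.card = n then (P s).toReal else 0 : ℝ) : ℂ) := fun s => by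
    split_ifs with hs
    · rw [norm_slaterVec hφ hs]; simp
    · rw [slaterVec_of_card_ne hs]; simp
  rw [h.trace_eq, tsum_congr e1, ← Complex.ofReal_tsum, Complex.ofReal_re, ← tsum_mul_left]
  have hs : Summable fun s : Finset J => if s.card = n then (P s).toReal else 0 :=
    (summable_toReal_pmf P).of_nonneg_of_le (fun s => by split_ifs <;> simp) fun s => by
      split_ifs <;> simp
  convert! (hs.mul_left ((n : ℝ) ^ m)).hasSum using 1
  funext s
  split_ifs with h
  · rw [h, mul_comm]
  · rw [mul_zero]

/-! ### Partial traces and reduced number densities -/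

/-- The weights of the partial trace of a mixture of Slater determinants. -/
def reductionWeight (P : PMF (Finset J)) (m k : ℕ) (q : Finset J × Finset J) : ℝ :=
  (m.factorial * k.factorial : ℝ) / (m + k).factorial *
    if q.1.card = m + k then pairWeight P q else 0

theorem reductionWeight_nonneg (P : PMF (Finset J)) (m k : ℕ) (q : Finset J × Finset J) :
    0 ≤ reductionWeight P m k q := by
  refine mul_nonneg (by positivity) ?_
  split_ifs
  exacts [pairWeight_nonneg P q, le_rfl]

theorem summable_reductionWeight (hP : IndependentOccupations P) (m k : ℕ) :
    Summable (reductionWeight P m k) := by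
  refine Summable.mul_left _ (hP.summable_pairWeight.of_nonneg_of_le (fun q => ?_) fun q => ?_) <;>
    split_ifs
  exacts [pairWeight_nonneg P q, le_rfl, le_rfl, pairWeight_nonneg P q]

/-- The partial trace of a mixture of Slater determinants. -/
def reduction (φ : J → H) (e : ∀ s : Finset J, Fin s.card ≃ s) (P : PMF (Finset J)) (m k : ℕ) :
    antisym H m →L[ℂ] antisym H m :=
  ∑' q, (reductionWeight P m k q : ℂ) • rankOne ℂ (slaterVec φ e m q.2) (slaterVec φ e m q.2)

theorem isMixture_reduction (hφ : Orthonormal ℂ φ) (hP : IndependentOccupations P) (m k : ℕ) :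
    IsMixture (reductionWeight P m k) (fun q => slaterVec φ e m q.2) (reduction φ e P m k) :=
  isMixture_tsum (reductionWeight_nonneg P m k) (summable_reductionWeight hP m k)
    fun q => norm_slaterVec_le hφ q.2

theorem IsMixture.hasSum_trace_comp {K ι : Type*} [NormedAddCommGroup K] [InnerProductSpace ℂ K]
    [CompleteSpace K] {r : ι → ℝ} {u : ι → K} {T : K →L[ℂ] K} (h : IsMixture r u T)
    (B : K →L[ℂ] K) : HasSum (fun s => (r s : ℂ) * inner ℂ (u s) (B (u s))) (trace (B ∘L T)) := by
  rw [h.trace_comp]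
  refine (Summable.of_norm_bounded (h.summable.mul_right ‖B‖) fun s => ?_).hasSum
  rw [norm_mul, Complex.norm_real, Real.norm_of_nonneg (h.nonneg s)]
  refine mul_le_mul_of_nonneg_left ?_ (h.nonneg s)
  calc ‖inner ℂ (u s) (B (u s))‖ ≤ ‖u s‖ * ‖B (u s)‖ := norm_inner_le_norm _ _
    _ ≤ 1 * ‖B (u s)‖ := mul_le_mul_of_nonneg_right (h.norm_le s) (norm_nonneg _)
    _ ≤ ‖B‖ := by
      rw [one_mul]
      exact (B.le_opNorm_of_le (h.norm_le s)).trans_eq (mul_one _)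

/-- Both traces are series; for each fixed s, the terms over t on the right add up to the single
term on the left by the reduction formula for one Slater determinant. -/
theorem isPartialTrace_reduction (hφ : Orthonormal ℂ φ) (hP : IndependentOccupations P)
    (m k : ℕ) :
    IsPartialTrace m k (component (slaterMixture φ e P) (m + k)) (reduction φ e P m k) := by
  have hred := isMixture_reduction (e := e) hφ hP m k
  refine ⟨hred.isTraceClass, fun B _ _ => ?_⟩
  rw [(isMixture_component (e := e) (P := P) hφ (m + k)).extendByZero.trace_comp]
  refine ((hred.hasSum_trace_comp B).prod_fiberwise fun s => ?_).tsum_eq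
  by_cases hs : s.card = m + k
  · rw [inner_slaterVec_ampliate hφ B hs, Finset.mul_sum, Finset.mul_sum]
    -- If t is not a subset of s the weight vanishes; if it has the wrong size the vector does.
    have h0 : ∀ t ∉ s.powersetCard m, ((reductionWeight P m k (s, t) : ℝ) : ℂ)
        * inner ℂ (slaterVec φ e m t) (B (slaterVec φ e m t)) = 0 := fun t ht => by
      rw [Finset.mem_powersetCard, not_and_or] at ht
      rcases ht with ht | ht
      · rw [reductionWeight, pairWeight, if_neg (c := t ⊆ s) ht]; simp
      · rw [slaterVec_of_card_ne ht]; simp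
    have hsum := hasSum_sum_of_ne_finset_zero (L := .unconditional _) h0
    refine (congrArg (HasSum _) (Finset.sum_congr rfl fun t ht => ?_)).mp hsum
    rw [reductionWeight, pairWeight, if_pos hs, if_pos (Finset.mem_powersetCard.1 ht).1]
    push_cast
    ring
  · rw [slaterVec_of_card_ne hs]
    simp [reductionWeight, hs, hasSum_zero]

theorem reducedSummand_slaterMixture (hφ : Orthonormal ℂ φ) (hP : IndependentOccupations P)
    (m k : ℕ) :
    reducedSummand m (slaterMixture φ e P) k
      = (((m + k).factorial : ℂ) / (k.factorial : ℂ)) • reduction φ e P m k := by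
  rw [reducedSummand, (isPartialTrace_reduction hφ hP m k).partialTrace_eq]

/-- The reduced number density of order `m` of a mixture of Slater determinants with independent
occupation numbers. -/
def occupationDensity (φ : J → H) (e : ∀ s : Finset J, Fin s.card ≃ s) (P : PMF (Finset J))
    (m : ℕ) : antisym H m →L[ℂ] antisym H m :=
  ∑' t : Finset J, ((m.factorial * ∏ j ∈ t, occProb P j : ℝ) : ℂ) •
    rankOne ℂ (slaterVec φ e m t) (slaterVec φ e m t)

theorem isMixture_occupationDensity (hφ : Orthonormal ℂ φ) (hP : IndependentOccupations P)
    (m : ℕ) :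
    IsMixture (fun t => m.factorial * ∏ j ∈ t, occProb P j) (slaterVec φ e m)
      (occupationDensity φ e P m) :=
  isMixture_tsum
    (fun _ => mul_nonneg (Nat.cast_nonneg _) (Finset.prod_nonneg fun j _ => occProb_nonneg P j))
    ((summable_finsetProd_of_summable_nonneg (occProb_nonneg P) hP.summable_occProb).mul_left _)
    (norm_slaterVec_le hφ)

/-- Summing over s first turns the pair weights into products of the p_j. The series over pairs is
kept so that it can be regrouped by particle number. -/
theorem hasSum_pairs_occupationDensity (hφ : Orthonormal ℂ φ) (hP : IndependentOccupations P)
    (m : ℕ) :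
    HasSum (fun q : Finset J × Finset J => ((m.factorial * pairWeight P q : ℝ) : ℂ) •
      rankOne ℂ (slaterVec φ e m q.2) (slaterVec φ e m q.2)) (occupationDensity φ e P m) := by
  have h := (isMixture_tsum (u := fun q : Finset J × Finset J => slaterVec φ e m q.2)
    (fun q => mul_nonneg (Nat.cast_nonneg m.factorial) (pairWeight_nonneg P q))
    (hP.summable_pairWeight.mul_left _) fun q => norm_slaterVec_le hφ q.2).hasSum
  have h' := ((Equiv.prodComm _ _).hasSum_iff.2 h).prod_fiberwise (fun t =>
    (((hP.hasSum_pairWeight_left t).mul_left (m.factorial : ℝ)).mapL Complex.ofRealCLM).smul_const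
      (rankOne ℂ (slaterVec φ e m t) (slaterVec φ e m t)))
  have h2 : occupationDensity φ e P m = _ := h'.tsum_eq
  rw [h2]
  exact h

theorem hasSum_reducedSummand (hφ : Orthonormal ℂ φ) (hP : IndependentOccupations P) (m : ℕ) :
    HasSum (reducedSummand m (slaterMixture φ e P)) (occupationDensity φ e P m) := by
  refine hasSum_of_hasSum_fiber (hasSum_pairs_occupationDensity (e := e) hφ hP m)
    -- Truncated subtraction puts sets with fewer than m elements into k = 0; they contribute
    -- nothing, having no subset of size m.
    (fun q => q.1.card - m) fun k => ?_
  rw [reducedSummand_slaterMixture hφ hP]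
  convert! (isMixture_reduction (e := e) hφ hP m k).hasSum.const_smul
    (((m + k).factorial : ℂ) / (k.factorial : ℂ)) using 1
  funext q
  rw [smul_smul]
  by_cases ht : q.2.card = m
  swap
  · rw [slaterVec_of_card_ne ht]; simp
  by_cases hq : q.2 ⊆ q.1
  swap
  · rw [reductionWeight, pairWeight, if_neg (c := q.2 ⊆ q.1) hq]; simp
  have hle := Finset.card_le_card hq
  by_cases hk : q.1.card = m + k
  · rw [if_pos (by omega), reductionWeight, if_pos hk]
    congr 1
    -- The factor (m+k)!/k! times m! k!/(m+k)! equals m! for every k.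
    have h1 : ((m + k).factorial : ℂ) ≠ 0 := by exact_mod_cast (m + k).factorial_ne_zero
    have h2 : (k.factorial : ℂ) ≠ 0 := by exact_mod_cast k.factorial_ne_zero
    push_cast
    field_simp
  · rw [if_neg (by omega), reductionWeight, if_neg hk]; simp

theorem reducedNumberDensity_slaterMixture (hφ : Orthonormal ℂ φ)
    (hP : IndependentOccupations P) (m : ℕ) :
    reducedNumberDensity m (slaterMixture φ e P) = occupationDensity φ e P m :=
  (hasSum_reducedSummand hφ hP m).tsum_eq

theorem reducedNumberDensityExists_slaterMixture (hφ : Orthonormal ℂ φ)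
    (hP : IndependentOccupations P) (m : ℕ) :
    ReducedNumberDensityExists m (slaterMixture φ e P) where
  isPartialTrace k := by
    have h := isPartialTrace_reduction (e := e) hφ hP m k
    rwa [h.partialTrace_eq]
  hasSum := by
    rw [reducedNumberDensity_slaterMixture hφ hP]
    exact hasSum_reducedSummand hφ hP m
  isTraceClass := by
    rw [reducedNumberDensity_slaterMixture hφ hP]
    exact (isMixture_occupationDensity hφ hP m).isTraceClass

/-! ### Evaluation on simple tensors of basis vectors -/

theorem occupationDensity_slaterVec (hφ : Orthonormal ℂ φ) (hP : IndependentOccupations P)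
    (m : ℕ) (s : Finset J) :
    occupationDensity φ e P m (slaterVec φ e m s)
      = ((m.factorial * ∏ j ∈ s, occProb P j : ℝ) : ℂ) • slaterVec φ e m s := by
  have h := (isMixture_occupationDensity (e := e) hφ hP m).hasSum.mapL
    (ContinuousLinearMap.apply ℂ (antisym H m) (slaterVec φ e m s))
  simp only [ContinuousLinearMap.apply_apply, smul_apply, rankOne_apply] at h
  rw [← h.tsum_eq, tsum_eq_single s fun t ht => ?_]
  · by_cases hs : s.card = m
    · rw [inner_self_eq_norm_sq_to_K, norm_slaterVec hφ hs]; simp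
    · rw [slaterVec_of_card_ne hs]; simp
  · rw [inner_slaterVec_eq_zero hφ ht]; simp

/-- For distinct indices the vector is a multiple of some Ψ(s), an eigenvector; with a repeated
index it is 0. -/
theorem occupationDensity_toAntisym_tprod (hφ : Orthonormal ℂ φ) (hP : IndependentOccupations P)
    {m : ℕ} (f : Fin m → J) :
    occupationDensity φ e P m (toAntisym (HilbertPow.tprod (φ ∘ f)))
      = ((m.factorial * ∏ i, occProb P (f i) : ℝ) : ℂ) • toAntisym (HilbertPow.tprod (φ ∘ f)) := by
  classical
  have e1 : toAntisym (HilbertPow.tprod (φ ∘ f))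
      = (Real.sqrt m.factorial : ℂ)⁻¹ • slater (φ ∘ f) := by
    rw [slater_eq, smul_smul, inv_mul_cancel₀ (sqrt_factorial_ne_zero m), one_smul]
  by_cases hf : Function.Injective f
  · obtain ⟨π, hπ⟩ := exists_slater_eq φ e hf
    rw [e1, hπ, map_smul, map_smul, occupationDensity_slaterVec hφ hP,
      Finset.prod_image fun i _ j _ h => hf h, smul_comm (sgn π), smul_comm _ (_ : ℂ)]
  · have h0 : slater (φ ∘ f) = 0 := slater_eq_zero fun h => hf h.of_comp
    rw [e1, h0, smul_zero, map_zero, smul_zero]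

/-- Bounded operators on the tensor power agree if they agree on the simple tensors of basis
vectors. -/
theorem HilbertPow.hom_ext_hilbertBasis (b : HilbertBasis J ℂ H) {n : ℕ} {E : Type*}
    [NormedAddCommGroup E] [NormedSpace ℂ E] {S T : HilbertPow H n →L[ℂ] E}
    (h : ∀ f : Fin n → J, S (HilbertPow.tprod (b ∘ f)) = T (HilbertPow.tprod (b ∘ f))) : S = T := by
  classical
  refine HilbertPow.hom_ext fun x => ?_
  -- `F` contains the positions whose entries need not be basis vectors; they are freed one at a
  -- time.
  suffices ∀ F : Finset (Fin n), ∀ x : Fin n → H, (∀ i ∉ F, x i ∈ Set.range b) →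
      S (HilbertPow.tprod x) = T (HilbertPow.tprod x) from
    this Finset.univ x fun i hi => absurd (Finset.mem_univ i) hi
  intro F
  induction F using Finset.induction_on with
  | empty =>
    intro x hx
    choose f hf using fun i => hx i (Finset.notMem_empty i)
    rw [← funext hf]
    exact h f
  | insert i F _ ih =>
    intro x hx
    let L : H →ₗ[ℂ] HilbertPow H n :=
      (HilbertPow.ofAlg n).toLinearMap ∘ₗ (PiTensorProduct.tprod ℂ).toLinearMap x i
    have hL : ∀ y, L y = HilbertPow.tprod (Function.update x i y) := fun y => rfl
    have hnorm : ∀ y, ‖L y‖ ≤ (∏ k ∈ Finset.univ.erase i, ‖x k‖) * ‖y‖ := by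
      intro y
      have h2 : ‖L y‖ ^ 2 = ((∏ k ∈ Finset.univ.erase i, ‖x k‖) * ‖y‖) ^ 2 := by
        have h3 := HilbertPow.inner_tprod (Function.update x i y) (Function.update x i y)
        simp only [inner_self_eq_norm_sq_to_K] at h3
        rw [← Finset.mul_prod_erase _ _ (Finset.mem_univ i), Function.update_self,
          Finset.prod_congr rfl fun k hk => by
            rw [Function.update_of_ne (Finset.ne_of_mem_erase hk)]] at h3
        rw [hL, mul_pow, mul_comm, ← Finset.prod_pow]
        exact_mod_cast h3
      exact le_of_sq_le_sq h2.le (by positivity)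
    let L' : H →L[ℂ] HilbertPow H n := L.mkContinuous _ hnorm
    -- As functions of the entry at position i, both sides are linear and bounded, and by induction
    -- they agree on the basis, whose span is dense.
    have hST : S ∘L L' = T ∘L L' := by
      refine ContinuousLinearMap.ext_on
        ((Submodule.dense_iff_topologicalClosure_eq_top).2 b.dense_span) ?_
      rintro _ ⟨j, rfl⟩
      refine ih (Function.update x i (b j)) fun k hk => ?_
      by_cases hki : k = i
      · subst hki
        exact ⟨j, by simp⟩
      · rw [Function.update_of_ne hki]
        exact hx k (by simp [hki, hk])
    have := congrArg (fun R : H →L[ℂ] E => R (x i)) hST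
    change S (HilbertPow.tprod (Function.update x i (x i)))
      = T (HilbertPow.tprod (Function.update x i (x i))) at this
    rwa [Function.update_eq_self] at this

theorem HilbertPow.tprod_smul {n : ℕ} (c : Fin n → ℂ) (x : Fin n → H) :
    HilbertPow.tprod (fun i => c i • x i) = (∏ i, c i) • HilbertPow.tprod x :=
  (congrArg (HilbertPow.ofAlg n) ((PiTensorProduct.tprod ℂ).map_smul_univ c x)).trans
    (map_smul (HilbertPow.ofAlg n) _ _)

theorem oneParticleOp_occupationDensity [CompleteSpace H] (hφ : Orthonormal ℂ φ)
    (hP : IndependentOccupations P) (j : J) :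
    oneParticleOp (occupationDensity φ e P 1) (φ j) = (occProb P j : ℂ) • φ j := by
  have h1 : oneParticle H (φ j) = toAntisym (HilbertPow.tprod (φ ∘ fun _ : Fin 1 => j)) :=
    Subtype.ext (antisymmetrizer_of_mem (tprod_one_mem (φ j))).symm
  have h2 := occupationDensity_toAntisym_tprod (e := e) hφ hP fun _ : Fin 1 => j
  rw [← h1] at h2
  change (oneParticle H).symm (occupationDensity φ e P 1 (oneParticle H (φ j))) = _
  rw [h2, map_smul, LinearIsometryEquiv.symm_apply_apply]
  simp

/-- The tensor power multiplies every rearrangement of a simple tensor of basis vectors by the same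
number ∏ p_j, so this scalar factors out of the antisymmetrizing sum and matches the eigenvalue n! ∏
p_j on the left. -/
theorem extendByZero_occupationDensity [CompleteSpace H] (b : HilbertBasis J ℂ H)
    (hP : IndependentOccupations P) (n : ℕ) :
    extendByZero (occupationDensity b e P n) =
      tensorPow (oneParticleOp (occupationDensity b e P 1)) n ∘L
        ((n.factorial : ℂ) • antisymmetrizer H n) := by
  refine HilbertPow.hom_ext_hilbertBasis b fun f => ?_
  have ht : ∀ π : Equiv.Perm (Fin n), tensorPow (oneParticleOp (occupationDensity b e P 1)) n
      (HilbertPow.tprod ((b ∘ f) ∘ π))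
        = ((∏ i, occProb P (f i) : ℝ) : ℂ) • HilbertPow.tprod ((b ∘ f) ∘ π) := fun π => by
    rw [tensorPow_tprod, ← Equiv.prod_comp π, Complex.ofReal_prod, ← HilbertPow.tprod_smul]
    exact congrArg _ (funext fun i => oneParticleOp_occupationDensity b.orthonormal hP _)
  rw [extendByZero_apply, occupationDensity_toAntisym_tprod b.orthonormal hP,
    ContinuousLinearMap.comp_apply, smul_apply, factorial_smul_antisymmetrizer_tprod,
    map_sum]
  simp only [map_smul, ht]
  simp only [smul_comm (sgn _), ← Finset.smul_sum]
  rw [← factorial_smul_antisymmetrizer_tprod, smul_smul, mul_comm]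
  push_cast
  rfl

end Mixture

end FermiFock

end

/-! ### The main theorem -/

theorem mainTheorem4 {H : Type*} [NormedAddCommGroup H] [InnerProductSpace ℂ H] [CompleteSpace H]
    {J : Type*} (φ : HilbertBasis J ℂ H) (e : ∀ s : Finset J, Fin s.card ≃ s)
    (P : PMF (Finset J)) (hP : FermiFock.IndependentOccupations P)
    (G : FermiFock.Fock H →L[ℂ] FermiFock.Fock H) (hG : G = FermiFock.slaterMixture φ e P) :
    FermiFock.IsDensityOperator G ∧ FermiFock.CommutesWithNumber G ∧
      (∀ m : ℕ, FermiFock.FiniteMoment m G) ∧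
      ∀ n : ℕ, FermiFock.ReducedNumberDensityExists n G ∧
        FermiFock.extendByZero (FermiFock.reducedNumberDensity n G) =
          FermiFock.tensorPow (FermiFock.oneParticleOp (FermiFock.reducedNumberDensity 1 G)) n ∘L
            ((n.factorial : ℂ) • FermiFock.antisymmetrizer H n) := by
  subst hG
  have hφ := φ.orthonormal
  refine ⟨FermiFock.isDensityOperator_slaterMixture hφ,
    FermiFock.commutesWithNumber_slaterMixture hφ,
    FermiFock.finiteMoment_slaterMixture hφ hP, fun n =>
    ⟨FermiFock.reducedNumberDensityExists_slaterMixture hφ hP n, ?_⟩⟩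
  rw [FermiFock.reducedNumberDensity_slaterMixture hφ hP,
    FermiFock.reducedNumberDensity_slaterMixture hφ hP]
  exact FermiFock.extendByZero_occupationDensity φ hP n
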